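/- **Conventions.** $\mathbb N=\{1,2,\dots\}$, $\mathbb T=\mathbb R/2\pi\mathbb Z$, and $|\cdot|$ is the Euclidean norm. Let $d=3$ or let $d\ge 2$ be even, let $m\in\{1,\dots,d-1\}$, let $(J_k)_{k\in\mathbb N}$ be a bounded sequence of non-negative integers, not identically $0$, and set $N_k:=(d-m)J_k$. Let $\mathcal T:=\prod_{k}\mathbb T^{N_k}$ be the (possibly infinite-dimensional) torus, with tangent space $\mathcal R:=\{\nu=(\nu_k)_k:\nu_k\in\mathbb R^{N_k},\ |\nu|_\infty:=\sup_k|\nu_k|<\infty\}$; for $\vartheta\in\mathcal T$ and $h\in\mathcal R$, $\vartheta+h$ denotes the translate of $\vartheta$ by $h$ modulo $2\pi$. For $S\in\mathbb N$ let $\mathcal C^S_{\rm div}(\mathbb T^d,\mathbb R^d)$ be the Banach space of divergence-free vector fields of class $\mathcal C^S$ on $\mathbb T^d$, with the seminorms $\|f\|_{n,\infty}=\sup_x\max_{|\alpha|=n}|\partial^\alpha f(x)|$, $0\le n\le S$. A map $U:\mathcal T\to\mathcal C^S_{\rm div}(\mathbb T^d,\mathbb R^d)$ is *of class $\mathcal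 C^1$* if it is Fréchet differentiable with respect to $|\cdot|_\infty$ with continuous Fréchet derivative ${\rm d}_\vartheta U(\vartheta)$. It is *of class $\mathcal C^1_b$* if moreover for each $n\in\{0,\dots,S\}$ there is $C_n>0$ with $\|U(\vartheta)\|_{n,\infty}\le C_n$ and $\|{\rm d}_\vartheta U(\vartheta)[h]\|_{n,\infty}\le C_n|h|_\infty$ for all $\vartheta\in\mathcal T$, $h\in\mathcal R$. It is an *embedding* if ${\rm d}_\vartheta U(\vartheta)$ is injective for every $\vartheta$ and $U$ is a homeomorphism onto its image for the (compact) product topology of $\mathcal T$. It is *non-symmetric* if for no $\vartheta\in\mathcal T$ the field $U(\vartheta)$ is invariant under a non-trivial one-parameter group of translations $x\mapsto x+\tau e$ ($e\in\mathbb R^d\setminus\{0\}$, $\tau\in\mathbb R$) of $\mathbb T^d$. For $\eta>0$, $\nu\in\mathcal R$ is *non-resonant* if $\sum_k\nu_k\cdot\ell_k\ne0$ for all $\ell=(\ell_k)_k$, $\ell_k\in\mathbb Z^{N_k}$, with $0<\sum_k k^\eta|\ell_k|<\infty$ (such an $\ell$ has only finitely many non-zero entries). A field $u:\mathbb R\to\mathcal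 C^S_{\rm div}(\mathbb T^d,\mathbb R^d)$ is *time almost-periodic* if $u(t)=U(\theta+\nu t)$ for all $t$, for some $\mathcal C^1$ embedding $U$, some $\theta\in\mathcal T$ and some non-resonant $\nu\in\mathcal R$. **Theorem (time almost-periodic solutions of the Euler equations).** Let $d,m,(J_k)_k$ be as above and let $S\in\mathbb N$. There is $\varepsilon_0\in(0,1)$ such that for every $\varepsilon\in(0,\varepsilon_0)$ and every $\nu\in\mathcal R$ with $$\sup_{k\in\mathbb N}\varepsilon^{-(S+1)(k-1)}|\nu_k|<\infty$$ there exist a non-symmetric $\mathcal C^1_b$ embedding $U:\mathcal T\to\mathcal C^S_{\rm div}(\mathbb T^d,\mathbb R^d)$ and initial data $u_\theta\in\mathcal C^S_{\rm div}(\mathbb T^d,\mathbb R^d)$, $\theta\in\mathcal T$, such that the function $$P(\vartheta):=(-\Delta)^{-1}\big[{\rm div}\,(U(\vartheta)\cdot\nabla U(\vartheta))\big]$$ (the zero-average solution of $-\Delta P(\vartheta)={\rm div}\,(U(\vartheta)\cdot\nabla U(\vartheta))$ on $\mathbb T^d$ in the sense of distributions) belongs to $\mathcal C^S(\mathbb T^d)$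 for every $\vartheta\in\mathcal T$, and, for every $\theta\in\mathcal T$, $u(t,\cdot)=U(\theta+\nu t)$, with $u(0,\cdot)=u_\theta$, is a classical solution of the incompressible Euler equations $$\partial_tu+u\cdot\nabla u+\nabla p=0,\qquad {\rm div}\,u=0\qquad\text{on }\mathbb R\times\mathbb T^d$$ with pressure $p(t,\cdot)=P(\theta+\nu t)$. If, for some $\eta>0$, $\nu$ is in addition non-resonant, then $u$ is time almost-periodic (with the same $\eta$) for every $\theta\in\mathcal T$. -/

import Mathlib

open scoped ENNReal BoundedContinuousFunction

noncomputable section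

namespace EulerAP

/-- The Euclidean space `ℝ^d`. -/
abbrev E (d : ℕ) : Type := EuclideanSpace ℝ (Fin d)

/-- The `i`-th vector of the canonical basis of `ℝ^d`. -/
def basisVec {d : ℕ} (i : Fin d) : E d := EuclideanSpace.single i 1

/-- `f` is `2π`-periodic in every variable, i.e. it is a function on `𝕋^d = (ℝ/2πℤ)^d`. -/
def PeriodicFun {d : ℕ} {F : Type*} (f : E d → F) : Prop :=
  ∀ i : Fin d, Function.Periodic f ((2 * Real.pi) • basisVec i)

/-- The partial derivative `∂_{σ 0} ⋯ ∂_{σ (n-1)} f (x)`; as `σ` ranges over all maps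
`Fin n → Fin d`, these are all the derivatives `∂^α f(x)` with `|α| = n`. -/
def pderiv {d n : ℕ} {F : Type*} [NormedAddCommGroup F] [NormedSpace ℝ F]
    (σ : Fin n → Fin d) (f : E d → F) (x : E d) : F :=
  iteratedFDeriv ℝ n f x fun j => basisVec (σ j)

theorem PeriodicFun.bounded {d : ℕ} {F : Type*} [NormedAddCommGroup F] {g : E d → F}
    (hg : PeriodicFun g) (hc : Continuous g) :
    ∃ C, ∀ x, ‖g x‖ ≤ C := by
  have hK : IsCompact (Metric.closedBall (0 : E d) (∑ _i : Fin d, 2 * Real.pi)) :=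
    isCompact_closedBall _ _
  obtain ⟨C, hC⟩ := hK.exists_bound_of_continuousOn hc.continuousOn
  refine ⟨C, fun x => ?_⟩
  let v : E d := ∑ i, (toIcoDiv Real.two_pi_pos 0 (x i)) • ((2 * Real.pi) • basisVec i)
  have hv : Function.Periodic g v := by
    refine Finset.sum_induction _ (Function.Periodic g) (fun a b ha hb => ha.add_period hb)
      (fun y => by simp) (fun i _ => (hg i).zsmul _)
  rw [← hv.sub_eq x]
  apply hC
  have hx : x = ∑ i, x i • (basisVec i : E d) := by
    ext j
    simp [basisVec, Pi.single_apply]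
  have hxv : x - v = ∑ i, (toIcoMod Real.two_pi_pos 0 (x i)) • (basisVec i : E d) := by
    conv_lhs => rw [hx]
    rw [← Finset.sum_sub_distrib]
    refine Finset.sum_congr rfl fun i _ => ?_
    rw [toIcoMod, sub_smul, ← smul_assoc]
  rw [mem_closedBall_zero_iff, hxv]
  refine (norm_sum_le _ _).trans (Finset.sum_le_sum fun i _ => ?_)
  have h := toIcoMod_mem_Ico Real.two_pi_pos 0 (x i)
  rw [norm_smul, Real.norm_of_nonneg h.1]
  simpa [basisVec] using h.2.le

/-! ### The space of `C^s` functions on the torus -/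

/-- The `C^s` functions on `𝕋^d` with values in `F`, as a space of periodic functions on `ℝ^d`. -/
def cPerSubmodule (s d : ℕ) (F : Type*) [NormedAddCommGroup F] [NormedSpace ℝ F] :
    Submodule ℝ (E d → F) where
  carrier := {f | ContDiff ℝ s f ∧ PeriodicFun f}
  zero_mem' := ⟨contDiff_const, fun _ _ => rfl⟩
  add_mem' := fun hf hg => ⟨hf.1.add hg.1, fun i => (hf.2 i).add (hg.2 i)⟩
  smul_mem' := fun c _ hf => ⟨hf.1.const_smul c, fun i x => congrArg (c • ·) (hf.2 i x)⟩

/-- The space `C^s(𝕋^d, F)`. It is a type of its own so that it carries the `C^s` norm below and not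
the topology of pointwise convergence. -/
def CPer (s d : ℕ) (F : Type*) [NormedAddCommGroup F] [NormedSpace ℝ F] : Type _ :=
  cPerSubmodule s d F

section Space

variable {s d : ℕ} {F : Type*} [NormedAddCommGroup F] [NormedSpace ℝ F]

instance : AddCommGroup (CPer s d F) := inferInstanceAs (AddCommGroup (cPerSubmodule s d F))

instance : Module ℝ (CPer s d F) := inferInstanceAs (Module ℝ (cPerSubmodule s d F))

instance : FunLike (CPer s d F) (E d) F where
  coe f := f.1
  coe_injective := fun _ _ h => Subtype.ext h

theorem CPer.contDiff (f : CPer s d F) : ContDiff ℝ s (f : E d → F) := f.2.1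

theorem CPer.periodic (f : CPer s d F) : PeriodicFun (f : E d → F) := f.2.2

theorem CPer.coe_add (f g : CPer s d F) : ((f + g : CPer s d F) : E d → F) = f + g := rfl

theorem CPer.coe_smul (c : ℝ) (f : CPer s d F) : ((c • f : CPer s d F) : E d → F) = c • f := rfl

theorem CPer.coe_zero : ((0 : CPer s d F) : E d → F) = 0 := rfl

theorem CPer.continuous_pderiv (f : CPer s d F) {n : ℕ} (hn : n ≤ s) (σ : Fin n → Fin d) :
    Continuous (pderiv σ f) := by
  have h := f.contDiff.continuous_iteratedFDeriv (m := n) (by exact_mod_cast hn)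
  exact (ContinuousEval.continuous_eval.comp (h.prodMk continuous_const))

theorem CPer.periodic_pderiv (f : CPer s d F) {n : ℕ} (σ : Fin n → Fin d) :
    PeriodicFun (pderiv σ f) := by
  intro i x
  unfold pderiv
  rw [← iteratedFDeriv_comp_add_right]
  congr 2
  exact funext fun y => f.periodic i y

theorem CPer.bounded_pderiv (f : CPer s d F) {n : ℕ} (hn : n ≤ s) (σ : Fin n → Fin d) :
    ∃ C, ∀ x, ‖pderiv σ f x‖ ≤ C :=
  (f.periodic_pderiv σ).bounded (f.continuous_pderiv hn σ)

/-- The derivative `∂_σ f`, of order at most `s`, of a `C^s` function on the torus, as a bounded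
continuous function. -/
def CPer.pderivBCF (n : Fin (s + 1)) (σ : Fin n → Fin d) : CPer s d F →ₗ[ℝ] (E d →ᵇ F) where
  toFun f := BoundedContinuousFunction.ofNormedAddCommGroup (pderiv σ f)
    (f.continuous_pderiv (Nat.lt_succ_iff.mp n.2) σ)
    (f.bounded_pderiv (Nat.lt_succ_iff.mp n.2) σ).choose
    (f.bounded_pderiv (Nat.lt_succ_iff.mp n.2) σ).choose_spec
  map_add' f g := by
    ext x
    have hn : ((n : ℕ) : WithTop ℕ∞) ≤ s := by exact_mod_cast Nat.lt_succ_iff.mp n.2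
    change pderiv σ (f + g : CPer s d F) x = pderiv σ f x + pderiv σ g x
    rw [pderiv, CPer.coe_add, iteratedFDeriv_add_apply (f.contDiff.of_le hn).contDiffAt
      (g.contDiff.of_le hn).contDiffAt]
    rfl
  map_smul' c f := by
    ext x
    have hn : ((n : ℕ) : WithTop ℕ∞) ≤ s := by exact_mod_cast Nat.lt_succ_iff.mp n.2
    change pderiv σ (c • f : CPer s d F) x = c • pderiv σ f x
    rw [pderiv, CPer.coe_smul, iteratedFDeriv_const_smul_apply (f.contDiff.of_le hn).contDiffAt]
    rfl

/-- All the derivatives of order at most `s`. -/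
def CPer.jet : CPer s d F →ₗ[ℝ] ((n : Fin (s + 1)) → (Fin n → Fin d) → (E d →ᵇ F)) :=
  LinearMap.pi fun n => LinearMap.pi fun σ => CPer.pderivBCF n σ

theorem CPer.jet_apply (f : CPer s d F) (n : Fin (s + 1)) (σ : Fin n → Fin d) (x : E d) :
    CPer.jet f n σ x = pderiv σ f x := rfl

theorem CPer.jet_injective : Function.Injective (CPer.jet : CPer s d F →ₗ[ℝ] _) := by
  intro f g h
  refine DFunLike.ext _ _ fun x => ?_
  have h0 := congrFun (congrFun h 0) (fun j => Fin.elim0 j)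
  have h1 := DFunLike.congr_fun h0 x
  rw [CPer.jet_apply, CPer.jet_apply] at h1
  exact h1

/-- The norm of `C^s(𝕋^d, F)`: the maximum of `|∂^α f(x)|` over all `x` and all `|α| ≤ s`. -/
instance : NormedAddCommGroup (CPer s d F) :=
  NormedAddCommGroup.induced (CPer s d F) ((n : Fin (s + 1)) → (Fin n → Fin d) → (E d →ᵇ F))
    CPer.jet CPer.jet_injective

instance : NormedSpace ℝ (CPer s d F) :=
  NormedSpace.induced ℝ (CPer s d F) ((n : Fin (s + 1)) → (Fin n → Fin d) → (E d →ᵇ F)) CPer.jet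

/-- The norm of `C^s(𝕋^d, F)` is what it should be. -/
theorem CPer.norm_le_iff (f : CPer s d F) {C : ℝ} (hC : 0 ≤ C) :
    ‖f‖ ≤ C ↔ ∀ n ≤ s, ∀ (σ : Fin n → Fin d) (x : E d), ‖pderiv σ f x‖ ≤ C := by
  change ‖CPer.jet f‖ ≤ C ↔ _
  simp only [pi_norm_le_iff_of_nonneg hC, BoundedContinuousFunction.norm_le hC, CPer.jet_apply]
  exact ⟨fun h n hn => h ⟨n, Nat.lt_succ_iff.mpr hn⟩, fun h n => h n (Nat.lt_succ_iff.mp n.2)⟩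

end Space

/-- The seminorm `‖f‖_{n,∞} = sup_x max_{|α| = n} |∂^α f(x)|`. -/
def supSeminorm {d : ℕ} {F : Type*} [NormedAddCommGroup F] [NormedSpace ℝ F]
    (n : ℕ) (f : E d → F) : ℝ :=
  ⨆ x : E d, ⨆ σ : Fin n → Fin d, ‖pderiv σ f x‖

/-- The divergence of a vector field on `ℝ^d`. -/
def divergence {d : ℕ} (f : E d → E d) (x : E d) : ℝ :=
  ∑ i : Fin d, fderiv ℝ f x (basisVec i) i

/-- The space `C^s_div(𝕋^d, ℝ^d)` of divergence-free vector fields of class `C^s`, with the `C^s`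
norm, for `s ≥ 1` (the differentiability condition is then automatic). -/
def CDiv (s d : ℕ) : Submodule ℝ (CPer s d (E d)) where
  carrier := {f | Differentiable ℝ f ∧ ∀ x, divergence f x = 0}
  zero_mem' := by
    refine ⟨differentiable_const 0, fun x => ?_⟩
    simp [divergence, CPer.coe_zero]
  add_mem' := by
    rintro f g ⟨hf, hf'⟩ ⟨hg, hg'⟩
    refine ⟨hf.add hg, fun x => ?_⟩
    have h := congrArg₂ (· + ·) (hf' x) (hg' x)
    simpa [divergence, CPer.coe_add, fderiv_add (hf x) (hg x), Finset.sum_add_distrib] using h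
  smul_mem' := by
    rintro c f ⟨hf, hf'⟩
    refine ⟨hf.const_smul c, fun x => ?_⟩
    have h := congrArg (c * ·) (hf' x)
    simpa [divergence, CPer.coe_smul, fderiv_const_smul (hf x), Finset.mul_sum] using h

/-- The vector field `(u · ∇) v`. -/
def convect {d : ℕ} (u v : E d → E d) (x : E d) : E d := fderiv ℝ v x (u x)

/-- `(u, p)` solves the incompressible Euler equations
`∂ₜ u + (u · ∇) u + ∇ p = 0`, `div u = 0` on `ℝ × 𝕋^d`, classically. -/
def IsEulerSolution {d : ℕ} (u : ℝ → E d → E d) (p : ℝ → E d → ℝ) : Prop :=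
  (∀ t, PeriodicFun (u t) ∧ PeriodicFun (p t)) ∧
  ∀ t x, DifferentiableAt ℝ (fun τ => u τ x) t ∧ DifferentiableAt ℝ (u t) x ∧
    DifferentiableAt ℝ (p t) x ∧
    deriv (fun τ => u τ x) t + convect (u t) (u t) x + gradient (p t) x = 0 ∧
    divergence (u t) x = 0

/-- The fundamental cell `(0, 2π]^d` of the torus. -/
def cell (d : ℕ) : Set (E d) := {x | ∀ i, x i ∈ Set.Ioc 0 (2 * Real.pi)}

/-- `q = (-Δ)⁻¹ [div G]` for a continuous vector field `G` on `𝕋^d`: `q` is the function on `𝕋^d` with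
zero average such that `-Δ q = div G` in the sense of distributions on `𝕋^d`, that is,
`∫ q (-Δ φ) = - ∫ G · ∇ φ` for all smooth functions `φ` on `𝕋^d`. -/
def IsInvNegLaplacianDiv {d : ℕ} (G : E d → E d) (q : E d → ℝ) : Prop :=
  Continuous G ∧ PeriodicFun G ∧ Continuous q ∧ PeriodicFun q ∧
  ∫ x in cell d, q x = 0 ∧
  ∀ φ : E d → ℝ, ContDiff ℝ (⊤ : ℕ∞) φ → PeriodicFun φ →
    ∫ x in cell d, q x * (- Laplacian.laplacian φ x) =
      - ∫ x in cell d, inner ℝ (G x) (gradient φ x)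

/-! ### The infinite dimensional torus -/

/-- The infinite dimensional torus `(𝕋^{N_k})_k`. Sequences are indexed by `k = 0, 1, 2, …`, so the
`k`-th entry here is the one that is usually numbered `k + 1`. -/
abbrev Torus (N : ℕ → ℕ) : Type := (k : ℕ) → Fin (N k) → AddCircle (2 * Real.pi)

/-- The tangent space `(ℝ^{N_k})_k` of bounded sequences, with the norm
`|ν|_∞ = sup_k |ν_k|`, where `|ν_k|` is the Euclidean norm. -/
abbrev Tangent (N : ℕ → ℕ) : Type :=
  lp (fun k => EuclideanSpace ℝ (Fin (N k))) ∞

/-- The projection of the tangent space to the torus. -/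
def toTorus {N : ℕ → ℕ} (h : Tangent N) : Torus N :=
  fun k i => ((h k i : ℝ) : AddCircle (2 * Real.pi))

section Embeddings

variable {N : ℕ → ℕ} {s d : ℕ}

/-- `U` is of class `C¹` (with respect to `|·|_∞`): Fréchet differentiable with continuous Fréchet
derivative, read in the charts `h ↦ ϑ + h` of the torus. -/
def IsC1 (U : Torus N → CDiv s d) : Prop :=
  ∀ ϑ, ContDiff ℝ 1 fun h : Tangent N => U (ϑ + toTorus h)

/-- The Fréchet derivative `d_ϑ U(ϑ)`. -/
def dTorus (U : Torus N → CDiv s d) (ϑ : Torus N) : Tangent N →L[ℝ] CDiv s d :=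
  fderiv ℝ (fun h : Tangent N => U (ϑ + toTorus h)) 0

/-- `U` is of class `C¹_b`: of class `C¹` and bounded with its derivative in all the seminorms. -/
def IsC1b (U : Torus N → CDiv s d) : Prop :=
  IsC1 U ∧ ∀ n ≤ s, ∃ C : ℝ, 0 < C ∧
    (∀ ϑ, supSeminorm n (U ϑ : CPer s d (E d)) ≤ C) ∧
    ∀ ϑ (h : Tangent N), supSeminorm n (dTorus U ϑ h : CPer s d (E d)) ≤ C * ‖h‖

/-- `U` is an embedding: its derivative is injective at every point, and `U` is a homeomorphism
onto its image when the torus carries the product topology, in which it is compact. -/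
def IsEmb (U : Torus N → CDiv s d) : Prop :=
  Topology.IsEmbedding U ∧ ∀ ϑ, Function.Injective (dTorus U ϑ)

/-- `U` is non-symmetric: no `U(ϑ)` is invariant under a 1-parameter group of translations. -/
def NonSymmetric (U : Torus N → CDiv s d) : Prop :=
  ∀ ϑ, ∀ e : E d, e ≠ 0 →
    ¬ ∀ (τ : ℝ) (x : E d), (U ϑ : CPer s d (E d)) (x + τ • e) = (U ϑ : CPer s d (E d)) x

end Embeddings

/-- `|ℓ|_η = ∑_{k ≥ 1} k^η |ℓ_k|` for a sequence of integer vectors. -/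
def etaNorm {N : ℕ → ℕ} (η : ℝ) (l : (k : ℕ) → Fin (N k) → ℤ) : ℝ≥0∞ :=
  ∑' k : ℕ, ENNReal.ofReal (((k : ℝ) + 1) ^ η * Real.sqrt (∑ i, ((l k i : ℤ) : ℝ) ^ 2))

/-- The sequence of frequencies `ν` is non-resonant: `∑_k ν_k · ℓ_k ≠ 0` for all integer `ℓ`
with `0 < |ℓ|_η < ∞` (such an `ℓ` has only finitely many nonzero entries). -/
def NonResonant {N : ℕ → ℕ} (η : ℝ) (ν : Tangent N) : Prop :=
  ∀ l : (k : ℕ) → Fin (N k) → ℤ, 0 < etaNorm η l → etaNorm η l < ⊤ →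
    ∑' k, ∑ i, ν k i * ((l k i : ℤ) : ℝ) ≠ 0

/-- `u` is time almost-periodic: `u(t) = U(θ + ν t)` for some `C¹` embedding `U` of the torus, some
`θ`, and some non-resonant sequence of frequencies `ν`. -/
def IsTimeAlmostPeriodic (N : ℕ → ℕ) (η : ℝ) {s d : ℕ} (u : ℝ → CDiv s d) : Prop :=
  ∃ (ν : Tangent N) (U : Torus N → CDiv s d) (θ : Torus N),
    NonResonant η ν ∧ IsC1 U ∧ IsEmb U ∧ ∀ t, u t = U (θ + toTorus (t • ν))

end EulerAP

end

open EulerAP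

/-!
The solution is a superposition of countably many plane vortices, each carried by its own shear
flow. Fix one axis `o` of the torus, and cut out of it a sequence of disjoint slabs orthogonal to
`o`, of width comparable to `2⁻ʲ`. In the `j`-th slab put a small circular vortex
in the plane spanned by `o` and another direction `i`; it is a stationary solution of the Euler
equations which does not depend on the other coordinates, and it vanishes outside the slab. Add to
it the shear flow `w χ(x_o) e_i`, with a cutoff `χ` that is constant where the vortex lives: the
vortex is transported rigidly in direction `i` with velocity `w` (`block_euler`). A vortex and its
shear flow, and the derivatives of both, vanish outside their slab, so different slabs do not
interact and the sum over all slabs solves the Euler equations (`VortexArray.euler`).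

There is one slab for each angle of the torus, whose velocity is the frequency of that angle, so the
motion is `ϑ ↦ θ + νt`. One further vortex, which does not move, is put in a slab for each direction
other than `o`; these make the field non-symmetric, because a vortex is not
invariant under translations (`VortexArray.nonSymmetric_field`). The position of each vortex can be
read off from the field, which gives the embedding property (`VortexArray.isEmb_field`).

The amplitudes of the vortices may be taken as small as needed. The velocities are given, and the
`C^S` norm of the `j`-th shear flow grows like a power of `4 ^ (S j)`
(`exists_norm_shear_le`). As boundedly many slabs belong to each index `k`, this is a factor that
is exponential in `k`, and the decay of `ν_k` compensates it if `ε` is small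
(`summable_shear_of_decay`). This makes the series converge in `C^S`, which is complete; as
the translates of a smooth field form a `C¹` curve in `C^S` (`exists_deriv_translate`), the sum is
of class `C¹` in the angles.

Circular vortices on the torus are written with the periodic function `well`, which is the square
of the distance to `2πℤ` where it is small. Finally, the pressure equation holds in the sense of
distributions because the derivative of the field with respect to the angles is
divergence-free (`isInvNegLaplacianDiv_of_euler`).
-/

namespace EulerAP

noncomputable section

/-! ### A periodic replacement for the square -/

/-- The square of the distance from `t` to `2πℤ`. The formula makes smoothness away from the odd
multiples of `π` visible. -/
def circleDistSq (t : ℝ) : ℝ := (2 * Real.arcsin (Real.sin (t / 2))) ^ 2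

theorem circleDistSq_periodic : Function.Periodic circleDistSq (2 * Real.pi) := by
  intro t
  unfold circleDistSq
  rw [show (t + 2 * Real.pi) / 2 = t / 2 + Real.pi by ring, Real.sin_add_pi, Real.arcsin_neg]
  ring

theorem circleDistSq_nonneg (t : ℝ) : 0 ≤ circleDistSq t := sq_nonneg _

theorem circleDistSq_eq_sq {t : ℝ} (h : |t| ≤ Real.pi) : circleDistSq t = t ^ 2 := by
  obtain ⟨h1, h2⟩ := abs_le.1 h
  unfold circleDistSq
  rw [Real.arcsin_sin (by linarith) (by linarith)]
  ring

theorem exists_circleDistSq_eq (t : ℝ) :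
    ∃ n : ℤ, |t - n * (2 * Real.pi)| ≤ Real.pi ∧
      circleDistSq t = (t - n * (2 * Real.pi)) ^ 2 := by
  have h := sub_toIcoDiv_zsmul_mem_Ico Real.two_pi_pos (-Real.pi) t
  rw [zsmul_eq_mul] at h
  refine ⟨toIcoDiv Real.two_pi_pos (-Real.pi) t, ?_, ?_⟩
  · exact abs_le.2 ⟨h.1, by linarith [h.2]⟩
  · rw [← circleDistSq_eq_sq, circleDistSq_periodic.sub_int_mul_eq]
    exact abs_le.2 ⟨h.1, by linarith [h.2]⟩

theorem continuous_circleDistSq : Continuous circleDistSq := by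
  unfold circleDistSq
  fun_prop

/-- A smooth function which is the identity on `(-∞, 1/4]` and is `1` on `[1, ∞)`. -/
def plateau (y : ℝ) : ℝ := 1 - Real.smoothTransition (4 / 3 * (1 - y)) * (1 - y)

theorem plateau_of_le {y : ℝ} (h : y ≤ 1 / 4) : plateau y = y := by
  rw [plateau, Real.smoothTransition.one_of_one_le (by linarith)]
  ring

theorem plateau_of_one_le {y : ℝ} (h : 1 ≤ y) : plateau y = 1 := by
  rw [plateau, Real.smoothTransition.zero_of_nonpos (by linarith)]
  ring

theorem min_le_plateau (y : ℝ) : min y 1 ≤ plateau y := by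
  rcases le_total 1 y with h | h
  · rw [plateau_of_one_le h]
    exact min_le_right _ _
  · refine (min_le_left _ _).trans ?_
    unfold plateau
    nlinarith [Real.smoothTransition.le_one (4 / 3 * (1 - y))]

theorem contDiff_plateau : ContDiff ℝ (⊤ : ℕ∞) plateau := by
  unfold plateau
  exact contDiff_const.sub ((Real.smoothTransition.contDiff.comp (by fun_prop)).mul (by fun_prop))

/-- A smooth `2π`-periodic function that coincides with the square of the distance to `2πℤ` where
it is less than `1/4`. -/
def well (t : ℝ) : ℝ := plateau (circleDistSq t)

theorem well_periodic : Function.Periodic well (2 * Real.pi) :=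
  fun t => congrArg plateau (circleDistSq_periodic t)

theorem well_nonneg (t : ℝ) : 0 ≤ well t :=
  (le_min (circleDistSq_nonneg t) zero_le_one).trans (min_le_plateau _)

theorem circleDistSq_lt_of_well_lt {t r : ℝ} (hr : r ≤ 1) (h : well t < r) :
    circleDistSq t < r := by
  have := (min_le_plateau (circleDistSq t)).trans_lt h
  rcases min_lt_iff.1 this with h | h
  · exact h
  · linarith

theorem well_eq_sq {t : ℝ} (h : |t| ≤ 1 / 2) : well t = t ^ 2 := by
  have hpi := Real.pi_gt_three
  rw [well, circleDistSq_eq_sq (by linarith), plateau_of_le]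
  rw [← sq_abs]
  nlinarith [abs_nonneg t]

theorem well_zero : well 0 = 0 := by
  rw [well_eq_sq (by norm_num)]
  norm_num

/-- Points where the well is small are close to a multiple of `2π`. -/
theorem exists_of_well_lt {t r : ℝ} (hr0 : 0 ≤ r) (hr : r ≤ 1) (h : well t < r ^ 2) :
    ∃ n : ℤ, |t - n * (2 * Real.pi)| < r := by
  obtain ⟨n, -, hn⟩ := exists_circleDistSq_eq t
  have h1 := circleDistSq_lt_of_well_lt (by nlinarith) h
  rw [hn] at h1
  exact ⟨n, abs_lt_of_sq_lt_sq h1 hr0⟩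

theorem well_eq_zero_iff {t : ℝ} : well t = 0 ↔ ∃ n : ℤ, t = n * (2 * Real.pi) := by
  constructor
  · intro h
    obtain ⟨n, -, hn⟩ := exists_circleDistSq_eq t
    refine ⟨n, ?_⟩
    have h1 : circleDistSq t ≤ 0 := by
      have := min_le_plateau (circleDistSq t)
      rw [show plateau (circleDistSq t) = 0 from h] at this
      rcases min_le_iff.1 this with h | h
      · exact h
      · linarith
    rw [hn] at h1
    have h2 : t - n * (2 * Real.pi) = 0 := by
      apply pow_eq_zero_iff (two_ne_zero) |>.1
      exact le_antisymm h1 (sq_nonneg _)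
    linarith
  · rintro ⟨n, rfl⟩
    have := well_periodic.int_mul n 0
    rw [zero_add] at this
    rw [this, well_zero]

theorem contDiff_well : ContDiff ℝ (⊤ : ℕ∞) well := by
  rw [contDiff_iff_contDiffAt]
  intro t
  by_cases h : 1 < circleDistSq t
  · have : well =ᶠ[nhds t] fun _ => 1 := by
      filter_upwards [continuous_circleDistSq.continuousAt.eventually_const_lt h] with u hu
      exact plateau_of_one_le hu.le
    exact contDiffAt_const.congr_of_eventuallyEq this
  · have hs : ∀ c : ℝ, c = 1 ∨ c = -1 → Real.sin (t / 2) ≠ c := by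
      rintro c hc hsin
      apply h
      unfold circleDistSq
      rw [hsin]
      have hpi := Real.pi_gt_three
      rcases hc with rfl | rfl
      · rw [Real.arcsin_one]; nlinarith
      · rw [Real.arcsin_neg_one]; nlinarith
    refine contDiff_plateau.contDiffAt.comp t ?_
    unfold circleDistSq
    refine (contDiffAt_const.mul ?_).pow 2
    exact ContDiffAt.comp (g := Real.arcsin) t
      (Real.contDiffAt_arcsin (hs _ (Or.inr rfl)) (hs _ (Or.inl rfl)))
      (Real.contDiff_sin.comp (contDiff_id.div_const 2)).contDiffAt

/-- The derivative of the well. -/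
def well' : ℝ → ℝ := deriv well

/-- The second derivative of the well. -/
def well'' : ℝ → ℝ := deriv well'

theorem contDiff_well' : ContDiff ℝ (⊤ : ℕ∞) well' :=
  ((contDiff_infty_iff_deriv).1 contDiff_well).2

theorem hasDerivAt_well (t : ℝ) : HasDerivAt well (well' t) t :=
  (contDiff_well.differentiable (by simp) t).hasDerivAt

theorem hasDerivAt_well' (t : ℝ) : HasDerivAt well' (well'' t) t :=
  (contDiff_well'.differentiable (by simp) t).hasDerivAt

theorem well'_periodic : Function.Periodic well' (2 * Real.pi) := by
  intro t
  unfold well'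
  rw [← deriv_comp_add_const]
  congr 1
  exact funext well_periodic

theorem well_eventuallyEq {t : ℝ} (h : well t < 1 / 4) :
    ∃ c : ℝ, well =ᶠ[nhds t] fun u => (u - c) ^ 2 := by
  obtain ⟨n, hn⟩ := exists_of_well_lt (t := t) (r := 1 / 2) (by norm_num) (by norm_num)
    (by linarith)
  refine ⟨n * (2 * Real.pi), ?_⟩
  have : ∀ᶠ u in nhds t, |u - n * (2 * Real.pi)| < 1 / 2 :=
    (by fun_prop : ContinuousAt (fun u : ℝ => |u - n * (2 * Real.pi)|) t).eventually_lt_const hn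
  filter_upwards [this] with u hu
  rw [← well_eq_sq hu.le, well_periodic.sub_int_mul_eq]

theorem well''_eq_two {t : ℝ} (h : well t < 1 / 4) : well'' t = 2 := by
  obtain ⟨c, hc⟩ := well_eventuallyEq h
  have h1 : well' =ᶠ[nhds t] fun u => 2 * (u - c) := by
    refine hc.deriv.trans (Filter.Eventually.of_forall fun u => ?_)
    have : HasDerivAt (fun u : ℝ => (u - c) ^ 2) (2 * (u - c)) u := by
      simpa using ((hasDerivAt_id u).sub_const c).fun_pow 2
    exact this.deriv
  rw [well'', h1.deriv_eq]
  have : HasDerivAt (fun u : ℝ => 2 * (u - c)) 2 t := by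
    simpa using ((hasDerivAt_id t).sub_const c).const_mul 2
  exact this.deriv

theorem well'_of_abs_lt {t : ℝ} (h : |t| < 1 / 2) : well' t = 2 * t := by
  have hc : well =ᶠ[nhds t] fun u => u ^ 2 := by
    have : ∀ᶠ u in nhds t, |u| < 1 / 2 :=
      (by fun_prop : ContinuousAt (fun u : ℝ => |u|) t).eventually_lt_const h
    filter_upwards [this] with u hu using well_eq_sq hu.le
  rw [well', hc.deriv_eq]
  simp

section Analysis

/-! ### Evaluation and differentiation on the space of `C^s` periodic functions -/

variable {s d : ℕ} {F : Type*} [NormedAddCommGroup F] [NormedSpace ℝ F]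

theorem eq_sum_smul_basisVec (x : E d) : x = ∑ i, x i • (basisVec i : E d) := by
  ext j
  simp [basisVec, Pi.single_apply]

/-- A continuous multilinear map on `ℝ^d` is bounded by its values on the basis vectors. -/
theorem opNorm_le_of_basisVec {n : ℕ} (A : ContinuousMultilinearMap ℝ (fun _ : Fin n => E d) F)
    {C : ℝ} (hC : 0 ≤ C) (h : ∀ σ : Fin n → Fin d, ‖A fun j => basisVec (σ j)‖ ≤ C) :
    ‖A‖ ≤ (d : ℝ) ^ n * C := by
  refine A.opNorm_le_bound (by positivity) fun v => ?_
  have hv : v = fun j => ∑ i, v j i • (basisVec i : E d) :=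
    funext fun j => eq_sum_smul_basisVec (v j)
  conv_lhs => rw [hv, ContinuousMultilinearMap.map_sum]
  have hbound : ∀ σ : Fin n → Fin d,
      ‖A fun j => v j (σ j) • (basisVec (σ j) : E d)‖ ≤ C * ∏ j, ‖v j‖ := by
    intro σ
    rw [ContinuousMultilinearMap.map_smul_univ, norm_smul, norm_prod, mul_comm]
    refine mul_le_mul (h σ) ?_ (by positivity) hC
    exact Finset.prod_le_prod (fun _ _ => norm_nonneg _) fun j _ => PiLp.norm_apply_le (v j) (σ j)
  refine (norm_sum_le _ _).trans ((Finset.sum_le_sum fun σ _ => hbound σ).trans_eq ?_)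
  simp
  ring

theorem CPer.norm_pderiv_le (f : CPer s d F) {n : ℕ} (hn : n ≤ s) (σ : Fin n → Fin d) (x : E d) :
    ‖pderiv σ f x‖ ≤ ‖f‖ :=
  (f.norm_le_iff (norm_nonneg f)).1 le_rfl n hn σ x

theorem CPer.norm_iteratedFDeriv_le (f : CPer s d F) {n : ℕ} (hn : n ≤ s) (x : E d) :
    ‖iteratedFDeriv ℝ n f x‖ ≤ (d : ℝ) ^ n * ‖f‖ :=
  opNorm_le_of_basisVec _ (norm_nonneg f) fun σ => f.norm_pderiv_le hn σ x

theorem CPer.norm_apply_le (f : CPer s d F) (x : E d) : ‖f x‖ ≤ ‖f‖ := by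
  simpa [pderiv] using f.norm_pderiv_le (Nat.zero_le s) Fin.elim0 x

theorem CPer.differentiable (hs : 1 ≤ s) (f : CPer s d F) : Differentiable ℝ f :=
  f.contDiff.differentiable (by exact_mod_cast Nat.one_le_iff_ne_zero.1 hs)

theorem CPer.norm_fderiv_le (hs : 1 ≤ s) (f : CPer s d F) (x : E d) :
    ‖fderiv ℝ f x‖ ≤ d * ‖f‖ := by
  have h := f.norm_iteratedFDeriv_le hs x
  rwa [norm_iteratedFDeriv_one, pow_one] at h

/-- Evaluation at a point, as a continuous linear map. -/
def CPer.evalL (x : E d) : CPer s d F →L[ℝ] F :=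
  LinearMap.mkContinuous
    { toFun := fun f => f x
      map_add' := fun _ _ => rfl
      map_smul' := fun _ _ => rfl } 1 fun f => by
    rw [one_mul]
    exact f.norm_apply_le x

/-- The derivative at a point, as a continuous linear map. -/
def CPer.fderivL (hs : 1 ≤ s) (x : E d) : CPer s d F →L[ℝ] (E d →L[ℝ] F) :=
  LinearMap.mkContinuous
    { toFun := fun f => fderiv ℝ f x
      map_add' := fun f g => by
        rw [CPer.coe_add, fderiv_add (f.differentiable hs x) (g.differentiable hs x)]
      map_smul' := fun c f => by
        rw [CPer.coe_smul, fderiv_const_smul (f.differentiable hs x), RingHom.id_apply] } d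
    fun f => f.norm_fderiv_le hs x

/-- The element of `C^s(𝕋^d, F)` given by a smooth periodic function. -/
def CPer.mk (f : E d → F) (hf : ContDiff ℝ (⊤ : ℕ∞) f) (hp : PeriodicFun f) : CPer s d F :=
  ⟨f, hf.of_le (by exact_mod_cast le_top), hp⟩

theorem pderiv_comp_sub {n : ℕ} (σ : Fin n → Fin d) (f : E d → F) (v : E d) :
    pderiv σ (fun x => f (x - v)) = fun x => pderiv σ f (x - v) := by
  funext x
  unfold pderiv
  rw [iteratedFDeriv_comp_sub]

/-! ### Completeness -/

instance [CompleteSpace F] : CompleteSpace (CPer s d F) := by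
  refine NormedAddCommGroup.completeSpace_of_summable_imp_tendsto fun u hu => ?_
  have hbd : ∀ (k i : ℕ) (x : E d), (k : ℕ∞) ≤ (s : ℕ∞) →
      ‖iteratedFDeriv ℝ k (u i) x‖ ≤ (d : ℝ) ^ k * ‖u i‖ := fun k i x hk =>
    (u i).norm_iteratedFDeriv_le (by exact_mod_cast hk) x
  have hsum : ∀ k : ℕ, (k : ℕ∞) ≤ (s : ℕ∞) → Summable fun i => (d : ℝ) ^ k * ‖u i‖ :=
    fun k _ => hu.mul_left _
  have hcd : ∀ i, ContDiff ℝ ((s : ℕ∞) : WithTop ℕ∞) (u i) := fun i => (u i).contDiff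
  let g : CPer s d F := ⟨fun x => ∑' i, u i x, contDiff_tsum hcd hsum hbd, fun i x =>
    tsum_congr fun j => (u j).periodic i x⟩
  refine ⟨g, ?_⟩
  have hpd : ∀ (n : ℕ), n ≤ s → ∀ (σ : Fin n → Fin d) (x : E d),
      HasSum (fun i => pderiv σ (u i) x) (pderiv σ g x) := by
    intro n hn σ x
    have hn' : (n : ℕ∞) ≤ (s : ℕ∞) := by exact_mod_cast hn
    have h1 : Summable fun i => iteratedFDeriv ℝ n (u i) x :=
      Summable.of_norm_bounded (hsum n hn') fun i => hbd n i x hn'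
    have h2 := h1.hasSum
    rw [← iteratedFDeriv_tsum_apply hcd hsum hbd hn' x] at h2
    exact h2.mapL (ContinuousMultilinearMap.apply ℝ (fun _ : Fin n => E d) F
      fun j => basisVec (σ j))
  rw [tendsto_iff_norm_sub_tendsto_zero]
  refine squeeze_zero (fun _ => norm_nonneg _) (fun N => ?_)
    (tendsto_sum_nat_add fun i => ‖u i‖)
  have hnn : 0 ≤ ∑' i, ‖u (i + N)‖ := tsum_nonneg fun _ => norm_nonneg _
  rw [CPer.norm_le_iff _ hnn]
  intro n hn σ x
  have h1 : pderiv σ (∑ i ∈ Finset.range N, u i - g : CPer s d F) x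
      = ∑ i ∈ Finset.range N, pderiv σ (u i) x - pderiv σ g x := by
    have := congrArg (fun J => J x) (map_sub (CPer.pderivBCF (F := F) (d := d)
      ⟨n, Nat.lt_succ_iff.2 hn⟩ σ) (∑ i ∈ Finset.range N, u i) g)
    rw [map_sum] at this
    simpa [CPer.pderivBCF] using this
  have h2 := (hasSum_nat_add_iff' N).2 (hpd n hn σ x)
  rw [h1, norm_sub_rev, ← h2.tsum_eq]
  have hsN : Summable fun i => ‖u (i + N)‖ := (summable_nat_add_iff N).2 hu
  exact tsum_of_norm_bounded hsN.hasSum fun i => (u (i + N)).norm_pderiv_le hn σ x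

theorem isClosed_CDiv (hs : 1 ≤ s) : IsClosed (CDiv s d : Set (CPer s d (E d))) := by
  have : (CDiv s d : Set (CPer s d (E d))) =
      ⋂ x : E d, {f | (∑ i : Fin d, CPer.fderivL (F := E d) hs x f (basisVec i) i) = 0} := by
    ext f
    simp only [Set.mem_iInter, Set.mem_ofPred_eq]
    exact ⟨fun h x => h.2 x, fun h => ⟨f.differentiable hs, fun x => h x⟩⟩
  rw [this]
  exact isClosed_iInter fun x => isClosed_eq (by fun_prop) continuous_const

theorem completeSpace_CDiv (hs : 1 ≤ s) : CompleteSpace (CDiv s d) :=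
  (isClosed_CDiv hs).completeSpace_coe

/-! ### Translations -/

/-- If a curve in a complete space is differentiable after an isometric embedding, then it is
differentiable. -/
theorem exists_hasDerivAt_of_isometry {G H : Type*} [NormedAddCommGroup G] [NormedSpace ℝ G]
    [CompleteSpace G] [NormedAddCommGroup H] [NormedSpace ℝ H] (L : G →ₗᵢ[ℝ] H)
    {f : ℝ → G} {D : H} {t : ℝ} (h : HasDerivAt (fun τ => L (f τ)) D t) :
    ∃ D' : G, L D' = D ∧ HasDerivAt f D' t := by
  have hcl : IsClosed (Set.range L) := L.isometry.isClosedEmbedding.isClosed_range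
  have hD : D ∈ Set.range L := by
    refine hcl.mem_of_tendsto (hasDerivAt_iff_tendsto_slope.1 h)
      (Filter.Eventually.of_forall fun τ => ?_)
    exact ⟨slope f t τ, by simp [slope_def_module]⟩
  obtain ⟨D', rfl⟩ := hD
  refine ⟨D', rfl, ?_⟩
  rw [hasDerivAt_iff_isLittleO] at h ⊢
  refine Asymptotics.IsLittleO.of_norm_left ?_
  simpa only [← map_sub, ← map_smul, L.norm_map] using h.norm_left

/-- The translations of a bounded `C²` function form a differentiable curve of bounded continuous
functions. -/
theorem hasDerivAt_translate_bcf {g g' g'' : E d → F} {v : E d} {C : ℝ}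
    (h1 : ∀ x t, HasDerivAt (fun τ : ℝ => g (x - τ • v)) (g' (x - t • v)) t)
    (h2 : ∀ x t, HasDerivAt (fun τ : ℝ => g' (x - τ • v)) (g'' (x - t • v)) t)
    (hC : ∀ x, ‖g'' x‖ ≤ C) {γ γ' : ℝ → (E d →ᵇ F)} (hγ : ∀ t x, γ t x = g (x - t • v))
    (hγ' : ∀ t x, γ' t x = g' (x - t • v)) (t : ℝ) : HasDerivAt γ (γ' t) t := by
  have hC0 : 0 ≤ C := (norm_nonneg _).trans (hC 0)
  rw [hasDerivAt_iff_isLittleO]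
  have key : ∀ τ, ‖γ τ - γ t - (τ - t) • γ' t‖ ≤ C * ‖(τ - t) ^ 2‖ := by
    intro τ
    rw [BoundedContinuousFunction.norm_le (by positivity)]
    intro x
    have hlip : ∀ r, ‖g' (x - r • v) - g' (x - t • v)‖ ≤ C * ‖r - t‖ := fun r =>
      Convex.norm_image_sub_le_of_norm_hasDerivWithin_le (s := Set.univ)
        (fun y _ => (h2 x y).hasDerivWithinAt) (fun y _ => hC _) convex_univ trivial trivial
    have hd : ∀ r, HasDerivAt (fun r : ℝ => g (x - r • v) - (r - t) • g' (x - t • v))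
        (g' (x - r • v) - g' (x - t • v)) r := by
      intro r
      have := (h1 x r).fun_sub (((hasDerivAt_id r).sub_const t).smul_const (g' (x - t • v)))
      simpa using this
    have := Convex.norm_image_sub_le_of_norm_hasDerivWithin_le (s := Set.uIcc t τ)
      (C := C * ‖τ - t‖) (x := t) (y := τ)
      (fun y _ => (hd y).hasDerivWithinAt) (fun y hy => (hlip y).trans ?_) (convex_uIcc _ _)
      Set.left_mem_uIcc Set.right_mem_uIcc
    · simp only [sub_self, zero_smul, sub_zero] at this
      rw [norm_pow, pow_two, ← mul_assoc]
      refine le_trans (le_of_eq ?_) this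
      congr 1
      simp only [BoundedContinuousFunction.coe_sub, BoundedContinuousFunction.coe_smul,
        Pi.sub_apply, hγ, hγ']
      abel
    · refine mul_le_mul_of_nonneg_left ?_ hC0
      exact Set.abs_sub_left_of_mem_uIcc hy
  refine Asymptotics.IsBigO.trans_isLittleO
    (Asymptotics.IsBigO.of_bound C (Filter.Eventually.of_forall key)) ?_
  have h0 : (fun τ : ℝ => τ - t) =o[nhds t] (fun _ => (1 : ℝ)) := by
    rw [Asymptotics.isLittleO_one_iff]
    exact ((continuous_id.sub continuous_const).tendsto' t 0 (by simp))
  simpa [pow_two] using (Asymptotics.isBigO_refl (fun τ : ℝ => τ - t) (nhds t)).mul_isLittleO h0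

end Analysis

section Translation

variable {s d : ℕ} {F : Type*} [NormedAddCommGroup F] [NormedSpace ℝ F]

theorem CPer.norm_le_of_translate {f g : CPer s d F} {v : E d} (h : ∀ x, f x = g (x - v)) :
    ‖f‖ ≤ ‖g‖ := by
  rw [CPer.norm_le_iff _ (norm_nonneg _)]
  intro n hn σ x
  rw [show (f : E d → F) = fun x => g (x - v) from funext h, pderiv_comp_sub]
  exact g.norm_pderiv_le hn σ _

theorem contDiff_pderiv {f : E d → F} (hf : ContDiff ℝ (⊤ : ℕ∞) f) {n : ℕ} (σ : Fin n → Fin d) :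
    ContDiff ℝ (⊤ : ℕ∞) (pderiv σ f) := by
  have h : ContDiff ℝ (⊤ : ℕ∞) (iteratedFDeriv ℝ n f) :=
    hf.iteratedFDeriv_right (by exact_mod_cast le_top)
  exact (ContinuousMultilinearMap.apply ℝ (fun _ : Fin n => E d) F
    fun j => basisVec (σ j)).contDiff.comp h

/-- Minus the derivative of `g` in the direction `v`. -/
def negDirDeriv (v : E d) (g : E d → F) (x : E d) : F := -fderiv ℝ g x v

theorem contDiff_negDirDeriv {v : E d} {g : E d → F} (hg : ContDiff ℝ (⊤ : ℕ∞) g) :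
    ContDiff ℝ (⊤ : ℕ∞) (negDirDeriv v g) := by
  unfold negDirDeriv
  exact ((hg.fderiv_right (by simp)).clm_apply contDiff_const).neg

theorem periodicFun_negDirDeriv {v : E d} {g : E d → F} (hg : PeriodicFun g) :
    PeriodicFun (negDirDeriv v g) := by
  intro i x
  unfold negDirDeriv
  rw [← fderiv_comp_add_right]
  congr 3
  exact funext fun y => hg i y

theorem hasDerivAt_translate {v : E d} {g : E d → F} (hg : ContDiff ℝ (⊤ : ℕ∞) g) (x : E d)
    (t : ℝ) : HasDerivAt (fun τ : ℝ => g (x - τ • v)) (negDirDeriv v g (x - t • v)) t := by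
  have h1 : HasDerivAt (fun τ : ℝ => x - τ • v) (-v) t := by
    simpa using ((hasDerivAt_id t).smul_const v).const_sub x
  have h2 := (hg.differentiable (by simp) (x - t • v)).hasFDerivAt.comp_hasDerivAt t h1
  rw [map_neg] at h2
  exact h2

/-- The translates `x ↦ g (x - t v)` of a smooth periodic function, as bounded continuous
functions. -/
def translateBCF (v : E d) (g : E d → F) (hg : ContDiff ℝ (⊤ : ℕ∞) g) (hp : PeriodicFun g)
    (t : ℝ) : E d →ᵇ F :=
  BoundedContinuousFunction.ofNormedAddCommGroup (fun x => g (x - t • v))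
    (hg.continuous.comp (by fun_prop)) (hp.bounded hg.continuous).choose
    fun _ => (hp.bounded hg.continuous).choose_spec _

theorem hasDerivAt_translateBCF (v : E d) (g : E d → F) (hg : ContDiff ℝ (⊤ : ℕ∞) g)
    (hp : PeriodicFun g) (t : ℝ) :
    HasDerivAt (translateBCF v g hg hp) (translateBCF v (negDirDeriv v g)
      (contDiff_negDirDeriv hg) (periodicFun_negDirDeriv hp) t) t := by
  have hg1 := contDiff_negDirDeriv (v := v) hg
  have hg2 := contDiff_negDirDeriv (v := v) hg1
  obtain ⟨C, hC⟩ := (periodicFun_negDirDeriv (v := v)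
    (periodicFun_negDirDeriv (v := v) hp)).bounded hg2.continuous
  exact hasDerivAt_translate_bcf (hasDerivAt_translate hg) (hasDerivAt_translate hg1) hC
    (fun _ _ => rfl) (γ' := translateBCF v (negDirDeriv v g)
      (contDiff_negDirDeriv hg) (periodicFun_negDirDeriv hp)) (fun _ _ => rfl) t

/-- The list of all derivatives of order at most `s`, as an isometry on divergence-free fields. -/
def CDiv.jetL : CDiv s d →ₗᵢ[ℝ] ((n : Fin (s + 1)) → (Fin n → Fin d) → (E d →ᵇ E d)) where
  toLinearMap := CPer.jet ∘ₗ (CDiv s d).subtype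
  norm_map' _ := rfl

/-- The translates of a smooth divergence-free field along a coordinate axis form a `C¹` curve in
`C^s`. -/
theorem exists_deriv_translate (hs : 1 ≤ s) {f : E d → E d} (hf : ContDiff ℝ (⊤ : ℕ∞) f)
    (hp : PeriodicFun f) (i : Fin d) {V : ℝ → CDiv s d}
    (hV : ∀ t x, (V t : CPer s d (E d)) x = f (x - t • basisVec i)) :
    ∃ V' : ℝ → CDiv s d, (∀ t, HasDerivAt V (V' t) t) ∧ Continuous V' ∧
      ∃ M, ∀ t, ‖V t‖ ≤ M ∧ ‖V' t‖ ≤ M := by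
  have : CompleteSpace (CDiv s d) := completeSpace_CDiv hs
  have hp' : ∀ {n : ℕ} (σ : Fin n → Fin d), PeriodicFun (pderiv σ f) := by
    intro n σ j x
    unfold pderiv
    rw [← iteratedFDeriv_comp_add_right]
    congr 2
    exact funext fun y => hp j y
  let J : ℝ → ((n : Fin (s + 1)) → (Fin n → Fin d) → (E d →ᵇ E d)) := fun t n σ =>
    translateBCF (basisVec i) (negDirDeriv (basisVec i) (pderiv σ f))
      (contDiff_negDirDeriv (contDiff_pderiv hf σ)) (periodicFun_negDirDeriv (hp' σ)) t
  have hJ : ∀ t, HasDerivAt (fun τ => CDiv.jetL (V τ)) (J t) t := by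
    intro t
    refine hasDerivAt_pi.2 fun n => hasDerivAt_pi.2 fun σ => ?_
    have := hasDerivAt_translateBCF (basisVec i) (pderiv σ f) (contDiff_pderiv hf σ) (hp' σ) t
    refine this.congr_of_eventuallyEq (Filter.Eventually.of_forall fun τ => ?_)
    refine BoundedContinuousFunction.ext fun x => ?_
    change pderiv σ (V τ : CPer s d (E d)) x = pderiv σ f (x - τ • basisVec i)
    rw [show ((V τ : CPer s d (E d)) : E d → E d) = fun x => f (x - τ • basisVec i) from
      funext (hV τ), pderiv_comp_sub]
  have hJc : Continuous J := by
    refine continuous_pi fun n => continuous_pi fun σ => ?_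
    exact continuous_iff_continuousAt.2 fun t => (hasDerivAt_translateBCF _ _ _ _ t).continuousAt
  choose V' hV' hVd using fun t => exists_hasDerivAt_of_isometry CDiv.jetL (hJ t)
  have hV'c : Continuous V' := by
    rw [(CDiv.jetL (s := s) (d := d)).isometry.isEmbedding.continuous_iff]
    exact hJc.congr fun t => (hV' t).symm
  have hVp : Function.Periodic V (2 * Real.pi) := by
    intro t
    refine Subtype.ext (DFunLike.ext _ _ fun x => ?_)
    rw [hV, hV, add_smul, ← sub_sub]
    exact (hp i).sub_eq _
  have hV'p : Function.Periodic V' (2 * Real.pi) := by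
    intro t
    refine ((hVd (t + 2 * Real.pi)).comp_add_const t (2 * Real.pi)).unique ?_
    exact (hVd t).congr_of_eventuallyEq (Filter.Eventually.of_forall hVp)
  have hVc : Continuous V := continuous_iff_continuousAt.2 fun t => (hVd t).continuousAt
  obtain ⟨M₁, hM₁⟩ := (hVp.compact_of_continuous Real.two_pi_pos.ne' hVc).isBounded.exists_norm_le
  obtain ⟨M₂, hM₂⟩ := (hV'p.compact_of_continuous Real.two_pi_pos.ne' hV'c).isBounded.exists_norm_le
  exact ⟨V', hVd, hV'c, max M₁ M₂, fun t => ⟨(hM₁ _ ⟨t, rfl⟩).trans (le_max_left _ _),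
    (hM₂ _ ⟨t, rfl⟩).trans (le_max_right _ _)⟩⟩

end Translation

section Blocks

variable {d : ℕ}

@[simp] theorem basisVec_self (i : Fin d) : (basisVec i : E d) i = 1 := by simp [basisVec]

theorem basisVec_ne {i j : Fin d} (h : j ≠ i) : (basisVec i : E d) j = 0 := by
  simp [basisVec, h]

theorem basisVec_apply (i j : Fin d) : (basisVec i : E d) j = if j = i then 1 else 0 := by
  simp [basisVec]

/-- The circular vortex in the plane of the coordinates `o` and `i`, with centre `x_o = c`,
`x_i = r` and radius `√R`. On its support `well` is the square of the distance to `2πℤ`. -/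
def vortex (o i : Fin d) (c R r : ℝ) (x : E d) : E d :=
  expNegInvGlue (R - (well (x o - c) + well (x i - r))) •
    (well' (x i - r) • basisVec o - well' (x o - c) • basisVec i)

/-- The flow in direction `i` with unit velocity in the slab `well (x_o - c) ≤ R` and at rest
outside the slab `well (x_o - c) < 2 R`. -/
def shear (o i : Fin d) (c R : ℝ) (x : E d) : E d :=
  Real.smoothTransition (2 - well (x o - c) / R) • basisVec i

/-- The pressure of `vortex o i c R r`: it is the primitive of the centripetal acceleration. -/
def vortexPressure (o i : Fin d) (c R r : ℝ) (x : E d) : ℝ :=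
  ∫ t in (0 : ℝ)..(well (x o - c) + well (x i - r)), 2 * expNegInvGlue (R - t) ^ 2

/-! ### Smoothness, periodicity and derivatives of the building blocks -/

theorem contDiff_coord (i : Fin d) : ContDiff ℝ (⊤ : ℕ∞) fun x : E d => x i :=
  (EuclideanSpace.proj (𝕜 := ℝ) i).contDiff

theorem contDiff_vortex (o i : Fin d) (c R r : ℝ) : ContDiff ℝ (⊤ : ℕ∞) (vortex o i c R r) := by
  have ho : ContDiff ℝ (⊤ : ℕ∞) fun x : E d => x o - c := (contDiff_coord o).sub contDiff_const
  have hi : ContDiff ℝ (⊤ : ℕ∞) fun x : E d => x i - r := (contDiff_coord i).sub contDiff_const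
  exact (expNegInvGlue.contDiff.comp (contDiff_const.sub
    ((contDiff_well.comp ho).add (contDiff_well.comp hi)))).smul
    (((contDiff_well'.comp hi).smul contDiff_const).sub
      ((contDiff_well'.comp ho).smul contDiff_const))

theorem contDiff_shear (o i : Fin d) (c R : ℝ) : ContDiff ℝ (⊤ : ℕ∞) (shear o i c R) := by
  have ho : ContDiff ℝ (⊤ : ℕ∞) fun x : E d => x o - c := (contDiff_coord o).sub contDiff_const
  exact (Real.smoothTransition.contDiff.comp (contDiff_const.sub
    ((contDiff_well.comp ho).div_const R))).smul contDiff_const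

theorem hasDerivAt_pressurePrimitive (R y : ℝ) :
    HasDerivAt (fun y => ∫ t in (0 : ℝ)..y, 2 * expNegInvGlue (R - t) ^ 2)
      (2 * expNegInvGlue (R - y) ^ 2) y := by
  have hc : Continuous fun t : ℝ => 2 * expNegInvGlue (R - t) ^ 2 :=
    continuous_const.mul
      (((expNegInvGlue.contDiff (n := 0)).continuous.comp (continuous_const.sub continuous_id)).pow
        2)
  exact intervalIntegral.integral_hasDerivAt_right (hc.intervalIntegrable _ _)
    hc.stronglyMeasurable.stronglyMeasurableAtFilter hc.continuousAt

theorem contDiff_vortexPressure (o i : Fin d) (c R r : ℝ) :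
    ContDiff ℝ (⊤ : ℕ∞) (vortexPressure o i c R r) := by
  have ho : ContDiff ℝ (⊤ : ℕ∞) fun x : E d => x o - c := (contDiff_coord o).sub contDiff_const
  have hi : ContDiff ℝ (⊤ : ℕ∞) fun x : E d => x i - r := (contDiff_coord i).sub contDiff_const
  have h1 : ContDiff ℝ (⊤ : ℕ∞) fun y => ∫ t in (0 : ℝ)..y, 2 * expNegInvGlue (R - t) ^ 2 := by
    rw [contDiff_infty_iff_deriv]
    refine ⟨fun y => (hasDerivAt_pressurePrimitive R y).differentiableAt, ?_⟩
    rw [funext fun y => (hasDerivAt_pressurePrimitive R y).deriv]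
    exact contDiff_const.mul
      ((expNegInvGlue.contDiff.comp (contDiff_const.sub contDiff_id)).pow 2)
  exact h1.comp ((contDiff_well.comp ho).add (contDiff_well.comp hi))

/-- A function of two coordinates which is periodic in each of them is periodic on `ℝ^d`. -/
theorem periodicFun_of_coords {F : Type*} {o i : Fin d} {f : E d → F} {g : ℝ → ℝ → F}
    (h1 : ∀ z, Function.Periodic (fun y => g y z) (2 * Real.pi))
    (h2 : ∀ y, Function.Periodic (g y) (2 * Real.pi)) (hf : ∀ x, f x = g (x o) (x i)) :
    PeriodicFun f := by
  intro j x
  rw [hf, hf]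
  simp only [PiLp.add_apply, PiLp.smul_apply, basisVec_apply, smul_eq_mul, mul_ite, mul_one,
    mul_zero]
  have e1 : ∀ z, g (x o + if o = j then 2 * Real.pi else 0) z = g (x o) z := by
    intro z
    split_ifs
    · exact h1 z _
    · rw [add_zero]
  rw [e1]
  split_ifs
  · exact h2 _ _
  · rw [add_zero]

theorem periodic_sub {F : Type*} {f : ℝ → F} {p : ℝ} (hf : Function.Periodic f p) (c y : ℝ) :
    f (y + p - c) = f (y - c) := by
  rw [add_sub_right_comm, hf]

theorem periodicFun_vortex (o i : Fin d) (c R r : ℝ) : PeriodicFun (vortex o i c R r) :=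
  periodicFun_of_coords
    (g := fun y z => expNegInvGlue (R - (well (y - c) + well (z - r))) •
      (well' (z - r) • basisVec o - well' (y - c) • basisVec i))
    (fun z y => by simp only [periodic_sub well_periodic, periodic_sub well'_periodic])
    (fun y z => by simp only [periodic_sub well_periodic, periodic_sub well'_periodic])
    fun x => rfl

theorem periodicFun_shear (o i : Fin d) (c R : ℝ) : PeriodicFun (shear o i c R) :=
  periodicFun_of_coords (o := o) (i := i)
    (g := fun y _ => Real.smoothTransition (2 - well (y - c) / R) • basisVec i)
    (fun z y => by simp only [periodic_sub well_periodic]) (fun y z => rfl) fun x => rfl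

theorem periodicFun_vortexPressure (o i : Fin d) (c R r : ℝ) :
    PeriodicFun (vortexPressure o i c R r) :=
  periodicFun_of_coords
    (g := fun y z => ∫ t in (0 : ℝ)..(well (y - c) + well (z - r)), 2 * expNegInvGlue (R - t) ^ 2)
    (fun z y => by simp only [periodic_sub well_periodic])
    (fun y z => by simp only [periodic_sub well_periodic]) fun x => rfl

theorem hasFDerivAt_coord_sub (i : Fin d) (c : ℝ) (x : E d) :
    HasFDerivAt (fun x : E d => x i - c) (EuclideanSpace.proj (𝕜 := ℝ) i) x :=
  (EuclideanSpace.proj (𝕜 := ℝ) i).hasFDerivAt.sub_const c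

theorem fderiv_shear (o i : Fin d) (c R : ℝ) (x v : E d) :
    fderiv ℝ (shear o i c R) x v = (v o * (-(deriv Real.smoothTransition
      (2 - well (x o - c) / R) * (well' (x o - c) / R)))) • basisVec i := by
  have h1 := (hasDerivAt_well (x o - c)).comp_hasFDerivAt x (hasFDerivAt_coord_sub o c x)
  have h2 := (((Real.smoothTransition.contDiff (n := 1)).differentiable (by simp)
    (2 - well (x o - c) / R)).hasDerivAt).comp_hasFDerivAt x ((h1.mul_const R⁻¹).const_sub 2)
  have h3 := h2.smul_const (basisVec i : E d)
  have h4 : fderiv ℝ (shear o i c R) x = _ := h3.fderiv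
  rw [h4]
  simp
  ring_nf

theorem fderiv_vortex (o i : Fin d) (c R r : ℝ) (x v : E d) :
    fderiv ℝ (vortex o i c R r) x v =
      (v o * (-deriv expNegInvGlue (R - (well (x o - c) + well (x i - r))) *
          well' (x o - c) * well' (x i - r)) +
        v i * (-deriv expNegInvGlue (R - (well (x o - c) + well (x i - r))) *
          well' (x i - r) ^ 2 +
          expNegInvGlue (R - (well (x o - c) + well (x i - r))) * well'' (x i - r))) • basisVec o +
      (v o * (deriv expNegInvGlue (R - (well (x o - c) + well (x i - r))) *
          well' (x o - c) ^ 2 -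
          expNegInvGlue (R - (well (x o - c) + well (x i - r))) * well'' (x o - c)) +
        v i * (deriv expNegInvGlue (R - (well (x o - c) + well (x i - r))) *
          well' (x o - c) * well' (x i - r))) • basisVec i := by
  have h1 := (hasDerivAt_well (x o - c)).comp_hasFDerivAt x (hasFDerivAt_coord_sub o c x)
  have h2 := (hasDerivAt_well (x i - r)).comp_hasFDerivAt x (hasFDerivAt_coord_sub i r x)
  have h3 := (((expNegInvGlue.contDiff (n := 1)).differentiable (by simp)
    (R - (well (x o - c) + well (x i - r)))).hasDerivAt).comp_hasFDerivAt x
      ((h1.add h2).const_sub R)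
  have h4 := (hasDerivAt_well' (x o - c)).comp_hasFDerivAt x (hasFDerivAt_coord_sub o c x)
  have h5 := (hasDerivAt_well' (x i - r)).comp_hasFDerivAt x (hasFDerivAt_coord_sub i r x)
  have h6 := h3.smul ((h5.smul_const (basisVec o : E d)).sub (h4.smul_const (basisVec i : E d)))
  have h7 : fderiv ℝ (vortex o i c R r) x = _ := h6.fderiv
  rw [h7]
  simp
  module

theorem gradient_vortexPressure (o i : Fin d) (c R r : ℝ) (x : E d) :
    gradient (vortexPressure o i c R r) x =
      (2 * expNegInvGlue (R - (well (x o - c) + well (x i - r))) ^ 2) •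
        (well' (x o - c) • basisVec o + well' (x i - r) • basisVec i) := by
  have h1 := (hasDerivAt_well (x o - c)).comp_hasFDerivAt x (hasFDerivAt_coord_sub o c x)
  have h2 := (hasDerivAt_well (x i - r)).comp_hasFDerivAt x (hasFDerivAt_coord_sub i r x)
  have h3 := (hasDerivAt_pressurePrimitive R (well (x o - c) + well (x i - r))).comp_hasFDerivAt x
    (h1.add h2)
  have h4 : HasGradientAt (vortexPressure o i c R r)
      ((2 * expNegInvGlue (R - (well (x o - c) + well (x i - r))) ^ 2) •
        (well' (x o - c) • basisVec o + well' (x i - r) • basisVec i)) x := by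
    rw [hasGradientAt_iff_hasFDerivAt]
    refine HasFDerivAt.congr_fderiv h3 ?_
    ext v
    simp [basisVec, EuclideanSpace.inner_single_left]
  exact h4.gradient

theorem divergence_vortex {o i : Fin d} (hoi : i ≠ o) (c R r : ℝ) (x : E d) :
    divergence (vortex o i c R r) x = 0 := by
  unfold divergence
  simp only [fderiv_vortex, PiLp.add_apply, PiLp.smul_apply, basisVec_apply, smul_eq_mul]
  simp only [mul_ite, mul_one, mul_zero, ite_mul, one_mul, zero_mul, Finset.sum_add_distrib]
  simp [hoi, hoi.symm]

theorem divergence_shear {o i : Fin d} (hoi : i ≠ o) (c R : ℝ) (x : E d) :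
    divergence (shear o i c R) x = 0 := by
  unfold divergence
  simp only [fderiv_shear, PiLp.smul_apply, basisVec_apply, smul_eq_mul]
  simp [hoi.symm]

theorem vortex_eq_translate {o i : Fin d} (hoi : i ≠ o) (c R r : ℝ) (x : E d) :
    vortex o i c R r x = vortex o i c R 0 (x - r • basisVec i) := by
  simp [vortex, basisVec_ne hoi.symm]

theorem vortexPressure_eq_translate {o i : Fin d} (hoi : i ≠ o) (c R r : ℝ) (x : E d) :
    vortexPressure o i c R r x = vortexPressure o i c R 0 (x - r • basisVec i) := by
  simp [vortexPressure, basisVec_ne hoi.symm]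

theorem hasDerivAt_vortex {o i : Fin d} (hoi : i ≠ o) (c R r : ℝ) (x : E d) :
    HasDerivAt (fun τ => vortex o i c R τ x)
      (-fderiv ℝ (vortex o i c R r) x (basisVec i)) r := by
  have h := hasDerivAt_translate (v := basisVec i) (contDiff_vortex o i c R 0) x r
  simp only [← vortex_eq_translate hoi] at h
  convert! h using 1
  unfold negDirDeriv
  rw [fderiv_vortex, fderiv_vortex]
  simp [basisVec_ne hoi.symm]

/-! ### Each vortex carried by its shear flow solves the Euler equations -/

theorem deriv_expNegInvGlue_of_nonpos {y : ℝ} (hy : y ≤ 0) : deriv expNegInvGlue y = 0 :=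
  IsLocalMin.deriv_eq_zero (Filter.Eventually.of_forall fun z => by
    rw [expNegInvGlue.zero_of_nonpos hy]
    exact expNegInvGlue.nonneg z)

theorem deriv_smoothTransition_of_nonpos {y : ℝ} (hy : y ≤ 0) :
    deriv Real.smoothTransition y = 0 :=
  IsLocalMin.deriv_eq_zero (Filter.Eventually.of_forall fun z => by
    rw [Real.smoothTransition.zero_of_nonpos hy]
    exact Real.smoothTransition.nonneg z)

theorem deriv_smoothTransition_of_one_le {y : ℝ} (hy : 1 ≤ y) :
    deriv Real.smoothTransition y = 0 :=
  IsLocalMax.deriv_eq_zero (Filter.Eventually.of_forall fun z => by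
    rw [Real.smoothTransition.one_of_one_le hy]
    exact Real.smoothTransition.le_one z)

/-- The Euler equations for one block: the first term is the time derivative of a vortex that
moves with velocity `w` in direction `i`. -/
theorem block_euler {o i : Fin d} (hoi : i ≠ o) (c r A w : ℝ) {R : ℝ} (hR : 0 < R)
    (hR' : R ≤ 1 / 4) (x : E d) :
    (A * w) • -fderiv ℝ (vortex o i c R r) x (basisVec i) +
      (w • fderiv ℝ (shear o i c R) x + A • fderiv ℝ (vortex o i c R r) x)
        (w • shear o i c R x + A • vortex o i c R r x) +
      A ^ 2 • gradient (vortexPressure o i c R r) x = 0 := by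
  simp only [add_apply, smul_apply, fderiv_vortex,
    fderiv_shear, gradient_vortexPressure]
  simp only [vortex, shear, PiLp.add_apply, PiLp.smul_apply, PiLp.sub_apply, basisVec_self,
    basisVec_ne hoi, basisVec_ne hoi.symm, smul_eq_mul]
  rcases le_or_gt R (well (x o - c) + well (x i - r)) with h | h
  · rw [deriv_expNegInvGlue_of_nonpos (by linarith), expNegInvGlue.zero_of_nonpos (by linarith)]
    simp
  · have ho := well_nonneg (x o - c)
    have hi := well_nonneg (x i - r)
    have hk : 1 ≤ 2 - well (x o - c) / R := by
      have : well (x o - c) / R ≤ 1 := (div_le_one hR).2 (by linarith)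
      linarith
    rw [deriv_smoothTransition_of_one_le hk, Real.smoothTransition.one_of_one_le hk,
      well''_eq_two (by linarith : well (x o - c) < 1 / 4),
      well''_eq_two (by linarith : well (x i - r) < 1 / 4)]
    module

theorem vortex_eq_zero {o i : Fin d} {c R r : ℝ} {x : E d}
    (h : R ≤ well (x o - c) + well (x i - r)) : vortex o i c R r x = 0 := by
  rw [vortex, expNegInvGlue.zero_of_nonpos (by linarith), zero_smul]

theorem fderiv_vortex_eq_zero {o i : Fin d} {c R r : ℝ} {x : E d}
    (h : R ≤ well (x o - c) + well (x i - r)) : fderiv ℝ (vortex o i c R r) x = 0 := by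
  ext1 v
  rw [fderiv_vortex, expNegInvGlue.zero_of_nonpos (by linarith),
    deriv_expNegInvGlue_of_nonpos (by linarith)]
  simp

theorem shear_eq_zero {o i : Fin d} {c R : ℝ} (hR : 0 < R) {x : E d}
    (h : 2 * R ≤ well (x o - c)) : shear o i c R x = 0 := by
  have : 2 ≤ well (x o - c) / R := (le_div_iff₀ hR).2 h
  rw [shear, Real.smoothTransition.zero_of_nonpos (by linarith), zero_smul]

theorem fderiv_shear_eq_zero {o i : Fin d} {c R : ℝ} (hR : 0 < R) {x : E d}
    (h : 2 * R ≤ well (x o - c)) : fderiv ℝ (shear o i c R) x = 0 := by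
  have : 2 ≤ well (x o - c) / R := (le_div_iff₀ hR).2 h
  ext1 v
  rw [fderiv_shear, deriv_smoothTransition_of_nonpos (by linarith)]
  simp

end Blocks

section IntegrationByParts

/-! ### Integration by parts on the torus -/

variable {d : ℕ}

theorem cell_eq_preimage (d : ℕ) :
    cell d = (WithLp.ofLp : E d → (Fin d → ℝ)) ⁻¹'
      Set.pi Set.univ fun _ => Set.Ioc 0 (2 * Real.pi) := by
  ext x
  simp [cell, Set.mem_pi]

theorem setIntegral_cell (f : E d → ℝ) :
    ∫ x in cell d, f x =
      ∫ y in Set.Icc (0 : Fin d → ℝ) (fun _ => 2 * Real.pi), f (WithLp.toLp 2 y) := by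
  have h := (PiLp.volume_preserving_ofLp (Fin d)).setIntegral_preimage_emb
    (MeasurableEquiv.toLp 2 (Fin d → ℝ)).symm.measurableEmbedding
    (fun y => f (WithLp.toLp 2 y)) (Set.pi Set.univ fun _ => Set.Ioc 0 (2 * Real.pi))
  rw [cell_eq_preimage]
  refine (h.trans ?_)
  exact MeasureTheory.setIntegral_congr_set
    (MeasureTheory.Measure.univ_pi_Ioc_ae_eq_Icc (μ := fun _ : Fin d => MeasureTheory.volume)
      (f := fun _ => (0 : ℝ)) (g := fun _ => 2 * Real.pi))

theorem integrableOn_cell {f : E d → ℝ} (hf : Continuous f) :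
    MeasureTheory.IntegrableOn f (cell d) := by
  refine (hf.continuousOn.integrableOn_compact
    (isCompact_closedBall (0 : E d) (∑ _i : Fin d, 2 * Real.pi))).mono_set fun x hx => ?_
  rw [mem_closedBall_zero_iff, eq_sum_smul_basisVec x]
  refine (norm_sum_le _ _).trans (Finset.sum_le_sum fun i _ => ?_)
  rw [norm_smul, Real.norm_of_nonneg (hx i).1.le]
  simpa [basisVec] using (hx i).2

theorem volume_real_cell (d : ℕ) :
    MeasureTheory.volume.real (cell d) = (2 * Real.pi) ^ d := by
  have h := (PiLp.volume_preserving_ofLp (Fin d)).measure_preimage_equiv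
    (f := (MeasurableEquiv.toLp 2 (Fin d → ℝ)).symm)
    (Set.pi Set.univ fun _ => Set.Ioc 0 (2 * Real.pi))
  have h' : MeasureTheory.volume (cell d) = MeasureTheory.volume
      (Set.pi Set.univ fun _ : Fin d => Set.Ioc 0 (2 * Real.pi)) := by
    rw [cell_eq_preimage]
    exact h
  rw [MeasureTheory.Measure.real, h', MeasureTheory.volume_pi_pi]
  simp [Real.pi_pos.le]

/-- The integral over the torus of a partial derivative vanishes. -/
theorem integral_cell_fderiv {g : E d → ℝ} (hg : ContDiff ℝ 1 g) (hp : PeriodicFun g)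
    (i : Fin d) : ∫ x in cell d, fderiv ℝ g x (basisVec i) = 0 := by
  obtain ⟨n, rfl⟩ : ∃ n, d = n + 1 := ⟨d - 1, by have := i.2; omega⟩
  let T : (Fin (n + 1) → ℝ) →L[ℝ] E (n + 1) :=
    (EuclideanSpace.equiv (Fin (n + 1)) ℝ).symm.toContinuousLinearMap
  have hT : ∀ j, T (Pi.single j 1) = basisVec j := fun j => rfl
  let f : Fin (n + 1) → (Fin (n + 1) → ℝ) → ℝ := fun j y => if j = i then g (T y) else 0
  let f' : Fin (n + 1) → (Fin (n + 1) → ℝ) → (Fin (n + 1) → ℝ) →L[ℝ] ℝ := fun j y =>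
    if j = i then (fderiv ℝ g (T y)).comp T else 0
  have hsum : ∀ y, ∑ j, f' j y (Pi.single j 1) = fderiv ℝ g (T y) (basisVec i) := by
    intro y
    rw [Finset.sum_eq_single i (fun j _ hj => by simp [f', hj]) (by simp)]
    simp [f', hT]
  have hcont : Continuous fun y => fderiv ℝ g (T y) (basisVec i) :=
    ((hg.continuous_fderiv (by simp)).comp T.continuous).clm_apply continuous_const
  have hle : (0 : Fin (n + 1) → ℝ) ≤ fun _ => 2 * Real.pi := fun _ => Real.two_pi_pos.le
  have hdiv := MeasureTheory.integral_divergence_of_hasFDerivAt_off_countable'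
    (0 : Fin (n + 1) → ℝ) (fun _ => 2 * Real.pi) hle f f' ∅ Set.countable_empty
    (fun j => by
      by_cases hj : j = i
      · simp only [f, hj, if_true]
        exact (hg.continuous.comp T.continuous).continuousOn
      · simp only [f, hj, if_false]
        exact continuousOn_const)
    (fun y _ j => by
      by_cases hj : j = i
      · simp only [f, f', hj, if_true]
        exact (hg.differentiable (by simp) (T y)).hasFDerivAt.comp y T.hasFDerivAt
      · simp only [f, f', hj, if_false]
        exact hasFDerivAt_const _ _)
    (by
      simp only [hsum]
      exact hcont.continuousOn.integrableOn_compact isCompact_Icc)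
  rw [setIntegral_cell]
  simp only [hsum] at hdiv
  refine hdiv.trans (Finset.sum_eq_zero fun j _ => ?_)
  by_cases hj : j = i
  · subst hj
    rw [sub_eq_zero]
    refine MeasureTheory.integral_congr_ae (Filter.Eventually.of_forall fun y => ?_)
    simp only [f, if_true]
    rw [← hp j (T (j.insertNth ((0 : Fin (n + 1) → ℝ) j) y))]
    congr 1
    ext k
    rcases Fin.eq_self_or_eq_succAbove j k with rfl | ⟨l, rfl⟩
    · simp [T, basisVec]
    · simp [T, basisVec]
  · simp [f, hj]

theorem inner_eq_sum (v w : E d) : inner ℝ v w = ∑ i, v i * w i := by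
  simp [PiLp.inner_apply, mul_comm]

theorem gradient_apply_coord {φ : E d → ℝ} {x : E d} (i : Fin d) :
    gradient φ x i = fderiv ℝ φ x (basisVec i) := by
  rw [← toDual_gradient (𝕜 := ℝ), InnerProductSpace.toDual_apply_apply, inner_eq_sum]
  simp [basisVec_apply]

theorem periodicFun_fderiv_apply {F : Type*} [NormedAddCommGroup F] [NormedSpace ℝ F]
    {φ : E d → F} (hp : PeriodicFun φ) (v : E d) : PeriodicFun fun x => fderiv ℝ φ x v := by
  intro i x
  change fderiv ℝ φ (x + _) v = fderiv ℝ φ x v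
  rw [← fderiv_comp_add_right]
  congr 2
  exact funext fun y => hp i y

theorem laplacian_eq_sum_fderiv {φ : E d → ℝ} (hφ : ContDiff ℝ (⊤ : ℕ∞) φ) (x : E d) :
    Laplacian.laplacian φ x =
      ∑ i, fderiv ℝ (fun y => fderiv ℝ φ y (basisVec i)) x (basisVec i) := by
  have h := congrFun (InnerProductSpace.laplacian_eq_iteratedFDeriv_orthonormalBasis φ
    (EuclideanSpace.basisFun (Fin d) ℝ)) x
  rw [h]
  refine Finset.sum_congr rfl fun i _ => ?_
  have hd : DifferentiableAt ℝ (fderiv ℝ φ) x :=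
    (hφ.fderiv_right (m := (⊤ : ℕ∞)) (by simp)).differentiable (by simp) x
  rw [iteratedFDeriv_two_apply, fderiv_clm_apply hd (differentiableAt_const _)]
  simp [basisVec, EuclideanSpace.basisFun_apply]

/-- Green's identity on the torus. -/
theorem integral_inner_gradient {q φ : E d → ℝ} (hq : ContDiff ℝ 1 q) (hqp : PeriodicFun q)
    (hφ : ContDiff ℝ (⊤ : ℕ∞) φ) (hφp : PeriodicFun φ) :
    ∫ x in cell d, inner ℝ (gradient q x) (gradient φ x) =
      ∫ x in cell d, q x * -Laplacian.laplacian φ x := by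
  have hφi : ∀ i, ContDiff ℝ 1 fun y => fderiv ℝ φ y (basisVec i) := fun i =>
    ((hφ.fderiv_right (m := (⊤ : ℕ∞)) (by simp)).of_le (by exact_mod_cast le_top)).clm_apply
      contDiff_const
  have hdi : ∀ i, Continuous fun x => fderiv ℝ q x (basisVec i) := fun i =>
    (hq.continuous_fderiv (by simp)).clm_apply continuous_const
  have hdd : ∀ i, Continuous fun x =>
      fderiv ℝ (fun y => fderiv ℝ φ y (basisVec i)) x (basisVec i) := fun i =>
    ((hφi i).continuous_fderiv (by simp)).clm_apply continuous_const
  have hz : ∀ i, ∫ x in cell d, (q x * fderiv ℝ (fun y => fderiv ℝ φ y (basisVec i)) x (basisVec i)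
      + fderiv ℝ φ x (basisVec i) * fderiv ℝ q x (basisVec i)) = 0 := by
    intro i
    rw [← integral_cell_fderiv (hq.mul (hφi i))
      (fun j => (hqp j).mul (periodicFun_fderiv_apply hφp (basisVec i) j)) i]
    refine MeasureTheory.integral_congr_ae (Filter.Eventually.of_forall fun x => ?_)
    have h1 := hq.differentiable (by simp) x
    have h2 := (hφi i).differentiable (by simp) x
    dsimp only
    rw [fderiv_fun_mul h1 h2]
    simp
  have hint : ∀ i, MeasureTheory.IntegrableOn (fun x =>
      q x * fderiv ℝ (fun y => fderiv ℝ φ y (basisVec i)) x (basisVec i) +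
        fderiv ℝ φ x (basisVec i) * fderiv ℝ q x (basisVec i)) (cell d) := fun i =>
    integrableOn_cell ((hq.continuous.mul (hdd i)).add ((hφi i).continuous.mul (hdi i)))
  have hsum : ∫ x in cell d, ∑ i, (q x * fderiv ℝ (fun y => fderiv ℝ φ y (basisVec i)) x
      (basisVec i) + fderiv ℝ φ x (basisVec i) * fderiv ℝ q x (basisVec i)) = 0 := by
    rw [MeasureTheory.integral_finsetSum _ fun i _ => hint i]
    exact Finset.sum_eq_zero fun i _ => hz i
  have hi1 : Continuous fun x => inner ℝ (gradient q x) (gradient φ x) := by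
    simp only [inner_eq_sum, gradient_apply_coord]
    exact continuous_finsetSum _ fun i _ => (hdi i).mul (hφi i).continuous
  have hi2 : Continuous fun x => q x * -Laplacian.laplacian φ x := by
    simp only [laplacian_eq_sum_fderiv hφ]
    exact hq.continuous.mul (continuous_finsetSum _ fun i _ => hdd i).neg
  rw [← sub_eq_zero, ← MeasureTheory.integral_sub (integrableOn_cell hi1) (integrableOn_cell hi2),
    ← hsum]
  refine MeasureTheory.integral_congr_ae (Filter.Eventually.of_forall fun x => ?_)
  simp only [inner_eq_sum, gradient_apply_coord, laplacian_eq_sum_fderiv hφ,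
    Finset.sum_add_distrib, ← Finset.mul_sum]
  rw [mul_neg, sub_neg_eq_add, add_comm]
  congr 1
  exact Finset.sum_congr rfl fun i _ => mul_comm _ _

/-- Divergence-free fields on the torus are orthogonal to gradients. -/
theorem integral_inner_of_divergence_eq_zero {D : E d → E d} (hD : ContDiff ℝ 1 D)
    (hDp : PeriodicFun D) (hdiv : ∀ x, divergence D x = 0) {φ : E d → ℝ}
    (hφ : ContDiff ℝ (⊤ : ℕ∞) φ) (hφp : PeriodicFun φ) :
    ∫ x in cell d, inner ℝ (D x) (gradient φ x) = 0 := by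
  have hφ1 : ContDiff ℝ 1 φ := hφ.of_le (by exact_mod_cast le_top)
  have hDi : ∀ i, ContDiff ℝ 1 fun y => D y i := fun i =>
    (EuclideanSpace.proj (𝕜 := ℝ) i).contDiff.comp hD
  have hDd : ∀ i x, fderiv ℝ (fun y => D y i) x (basisVec i) = fderiv ℝ D x (basisVec i) i := by
    intro i x
    have := ((EuclideanSpace.proj (𝕜 := ℝ) i).hasFDerivAt.comp x
      (hD.differentiable (by simp) x).hasFDerivAt).fderiv
    exact congrArg (fun L : E d →L[ℝ] ℝ => L (basisVec i)) this
  have hint : ∀ i, MeasureTheory.IntegrableOn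
      (fun x => fderiv ℝ (fun y => D y i * φ y) x (basisVec i)) (cell d) := fun i =>
    integrableOn_cell
      ((((hDi i).mul hφ1).continuous_fderiv (by simp)).clm_apply continuous_const)
  have hsum : ∫ x in cell d, ∑ i, fderiv ℝ (fun y => D y i * φ y) x (basisVec i) = 0 := by
    rw [MeasureTheory.integral_finsetSum _ fun i _ => hint i]
    refine Finset.sum_eq_zero fun i _ => integral_cell_fderiv ((hDi i).mul hφ1) (fun j x => ?_) i
    dsimp only
    rw [hDp j, hφp j]
  rw [← hsum]
  refine MeasureTheory.integral_congr_ae (Filter.Eventually.of_forall fun x => ?_)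
  have hm : ∀ i, fderiv ℝ (fun y => D y i * φ y) x (basisVec i) =
      D x i * fderiv ℝ φ x (basisVec i) + φ x * fderiv ℝ D x (basisVec i) i := by
    intro i
    rw [fderiv_fun_mul ((hDi i).differentiable (by simp) x) (hφ1.differentiable (by simp) x)]
    simp [hDd]
  simp only [hm, inner_eq_sum, gradient_apply_coord, Finset.sum_add_distrib, ← Finset.mul_sum]
  have := hdiv x
  unfold divergence at this
  rw [this, mul_zero, add_zero]

/-- If the convective acceleration of a divergence-free field is the sum of `-∇q` and of a
divergence-free field, then `q` is its pressure. -/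
theorem isInvNegLaplacianDiv_of_euler {s : ℕ} (hs : 1 ≤ s) {u D : CDiv s d} {q : CPer s d ℝ}
    (h : ∀ x, (D : CPer s d (E d)) x +
      convect (u : CPer s d (E d)) (u : CPer s d (E d)) x + gradient q x = 0)
    (hq : ∫ x in cell d, q x = 0) :
    IsInvNegLaplacianDiv (convect (u : CPer s d (E d)) (u : CPer s d (E d))) q := by
  have hs1 : (1 : WithTop ℕ∞) ≤ s := by exact_mod_cast hs
  have hu1 : ContDiff ℝ 1 (u : CPer s d (E d)) := (u : CPer s d (E d)).contDiff.of_le hs1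
  have hD1 : ContDiff ℝ 1 (D : CPer s d (E d)) := (D : CPer s d (E d)).contDiff.of_le hs1
  have hq1 : ContDiff ℝ 1 q := q.contDiff.of_le hs1
  have hc : Continuous (convect (u : CPer s d (E d)) (u : CPer s d (E d))) :=
    (hu1.continuous_fderiv (by simp)).clm_apply hu1.continuous
  refine ⟨hc, fun i x => ?_, hq1.continuous, q.periodic, hq, fun φ hφ hφp => ?_⟩
  · unfold convect
    rw [(u : CPer s d (E d)).periodic i x]
    exact periodicFun_fderiv_apply (u : CPer s d (E d)).periodic _ i x
  · have hG : ∀ x, convect (u : CPer s d (E d)) (u : CPer s d (E d)) x =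
        -((D : CPer s d (E d)) x + gradient q x) := fun x => by
      rw [eq_neg_iff_add_eq_zero, ← h x]
      abel
    have hφc : ∀ i, Continuous fun y => fderiv ℝ φ y (basisVec i) := fun i =>
      (hφ.continuous_fderiv (by simp)).clm_apply continuous_const
    have hi1 : Continuous fun x => inner ℝ ((D : CPer s d (E d)) x) (gradient φ x) := by
      simp only [inner_eq_sum, gradient_apply_coord]
      exact continuous_finsetSum _ fun i _ =>
        ((EuclideanSpace.proj (𝕜 := ℝ) i).continuous.comp hD1.continuous).mul (hφc i)
    have hi2 : Continuous fun x => inner ℝ (gradient q x) (gradient φ x) := by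
      simp only [inner_eq_sum, gradient_apply_coord]
      exact continuous_finsetSum _ fun i _ =>
        ((hq1.continuous_fderiv (by simp)).clm_apply continuous_const).mul (hφc i)
    simp only [hG, inner_neg_left, inner_add_left]
    rw [MeasureTheory.integral_neg, neg_neg, MeasureTheory.integral_add (integrableOn_cell hi1)
      (integrableOn_cell hi2), integral_inner_of_divergence_eq_zero hD1
      (D : CPer s d (E d)).periodic D.2.2 hφ hφp, zero_add,
      integral_inner_gradient hq1 q.periodic hφ hφp]

end IntegrationByParts

section Slabs

/-! ### The slabs -/

/-- The centre of the `j`-th slab. -/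
def slabCenter (j : ℕ) : ℝ := (1 / 2) ^ j

/-- The squared radius of the vortices in the `j`-th slab. -/
def slabRadiusSq (j : ℕ) : ℝ := (1 / 4) ^ j / 32

theorem slabRadiusSq_pos (j : ℕ) : 0 < slabRadiusSq j := by
  unfold slabRadiusSq
  positivity

theorem slabRadiusSq_le (j : ℕ) : slabRadiusSq j ≤ 1 / 32 := by
  unfold slabRadiusSq
  have : (1 / 4 : ℝ) ^ j ≤ 1 := pow_le_one₀ (by norm_num) (by norm_num)
  linarith

/-- The `j`-th slab has half-width `2⁻ʲ / 4`. -/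
theorem exists_of_mem_slab {t : ℝ} {j : ℕ}
    (h : well (t - slabCenter j) < 2 * slabRadiusSq j) :
    ∃ n : ℤ, |t - n * (2 * Real.pi) - (1 / 2) ^ j| < (1 / 2) ^ j / 4 := by
  have h1 : (1 / 2 : ℝ) ^ j ≤ 1 := pow_le_one₀ (by norm_num) (by norm_num)
  have h2 : 2 * slabRadiusSq j = ((1 / 2) ^ j / 4) ^ 2 := by
    rw [slabRadiusSq, show (1 / 4 : ℝ) = (1 / 2) ^ 2 by norm_num, ← pow_mul, mul_comm 2 j, pow_mul]
    ring
  rw [h2] at h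
  obtain ⟨n, hn⟩ := exists_of_well_lt (by positivity) (by linarith) h
  refine ⟨n, ?_⟩
  rw [slabCenter] at hn
  rwa [sub_right_comm] at hn

theorem slab_disjoint {i j : ℕ} (hij : i ≠ j) {t : ℝ}
    (hi : well (t - slabCenter i) < 2 * slabRadiusSq i) :
    2 * slabRadiusSq j ≤ well (t - slabCenter j) := by
  by_contra! hj
  wlog h : i < j generalizing i j
  · exact this hij.symm hj hi (lt_of_le_of_ne (not_lt.1 h) hij.symm)
  obtain ⟨n, hn⟩ := exists_of_mem_slab hi
  obtain ⟨n', hn'⟩ := exists_of_mem_slab hj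
  have hpi := Real.pi_gt_three
  have h1 : (1 / 2 : ℝ) ^ i ≤ 1 := pow_le_one₀ (by norm_num) (by norm_num)
  have h2 : (1 / 2 : ℝ) ^ j ≤ (1 / 2) ^ i / 2 := by
    have : (1 / 2 : ℝ) ^ j ≤ (1 / 2) ^ (i + 1) :=
      pow_le_pow_of_le_one (by norm_num) (by norm_num) h
    rw [pow_succ] at this
    linarith
  have h3 : (0 : ℝ) < (1 / 2) ^ j := by positivity
  obtain ⟨a1, a2⟩ := abs_lt.1 hn
  obtain ⟨b1, b2⟩ := abs_lt.1 hn'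
  have hnn : n = n' := by
    rcases lt_trichotomy n n' with h | h | h
    · have : (n : ℝ) + 1 ≤ n' := by exact_mod_cast h
      nlinarith
    · exact h
    · have : (n' : ℝ) + 1 ≤ n := by exact_mod_cast h
      nlinarith
  subst hnn
  linarith

/-- The plane through the origin does not meet any slab. -/
theorem zero_not_mem_slab (j : ℕ) : 2 * slabRadiusSq j ≤ well (0 - slabCenter j) := by
  by_contra! hj
  obtain ⟨n, hn⟩ := exists_of_mem_slab hj
  have hpi := Real.pi_gt_three
  have h1 : (1 / 2 : ℝ) ^ j ≤ 1 := pow_le_one₀ (by norm_num) (by norm_num)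
  have h3 : (0 : ℝ) < (1 / 2) ^ j := by positivity
  obtain ⟨a1, a2⟩ := abs_lt.1 hn
  rcases le_or_gt 0 n with h | h
  · have : (0 : ℝ) ≤ n := by exact_mod_cast h
    nlinarith
  · have : (n : ℝ) + 1 ≤ 0 := by exact_mod_cast h
    nlinarith

end Slabs

section Array

/-! ### Arrays of vortices -/

/-- The indices of the vortices: one for each angle of the torus, and one vortex at rest for each
direction other than `o`. -/
abbrev VortexIndex (N : ℕ → ℕ) {d : ℕ} (o : Fin d) : Type :=
  (Σ k, Fin (N k)) ⊕ {i : Fin d // i ≠ o}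

/-- The position of the vortices: each has its own slab orthogonal to the axis `o`, and
spins in the plane spanned by `o` and the direction in which it moves. -/
structure VortexLayout (N : ℕ → ℕ) (d : ℕ) where
  /-- The axis orthogonal to the slabs. -/
  o : Fin d
  /-- The direction of motion of each vortex. -/
  dir : VortexIndex N o → Fin d
  dir_ne : ∀ b, dir b ≠ o
  dir_inr : ∀ i, dir (Sum.inr i) = i
  /-- The number of the slab of each vortex. -/
  slot : VortexIndex N o → ℕ
  slot_injective : Function.Injective slot
  two_le : 2 ≤ d

variable {N : ℕ → ℕ} {s d : ℕ}

/-- The angle that gives the position of a vortex. -/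
def phase {o : Fin d} : VortexIndex N o → Torus N → AddCircle (2 * Real.pi)
  | Sum.inl a => fun ϑ => ϑ a.1 a.2
  | Sum.inr _ => fun _ => 0

/-- The component of a tangent vector in the direction of the angle of a vortex. -/
def speed {o : Fin d} : VortexIndex N o → (Tangent N →L[ℝ] ℝ)
  | Sum.inl a => (EuclideanSpace.proj a.2).comp
      (lp.evalCLM ℝ (fun k => EuclideanSpace ℝ (Fin (N k))) ∞ a.1)
  | Sum.inr _ => 0

theorem speed_inl {o : Fin d} (a : Σ k, Fin (N k)) (h : Tangent N) :
    speed (o := o) (Sum.inl a) h = h a.1 a.2 := rfl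

theorem abs_speed_le {o : Fin d} (b : VortexIndex N o) (h : Tangent N) : |speed b h| ≤ ‖h‖ := by
  rcases b with a | i
  · rw [speed_inl, ← Real.norm_eq_abs]
    exact (PiLp.norm_apply_le _ _).trans (lp.norm_apply_le_norm (by simp) h a.1)
  · simp [speed]

theorem norm_speed_le {o : Fin d} (b : VortexIndex N o) :
    ‖(speed b : Tangent N →L[ℝ] ℝ)‖ ≤ 1 :=
  ContinuousLinearMap.opNorm_le_bound _ zero_le_one fun h => by
    rw [one_mul]
    exact abs_speed_le b h

theorem phase_add_toTorus {o : Fin d} (b : VortexIndex N o) (ϑ : Torus N) (h : Tangent N) :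
    phase b (ϑ + toTorus h) = phase b ϑ + (speed b h : ℝ) := by
  rcases b with a | i
  · rfl
  · simp [phase, speed]

theorem continuous_phase {o : Fin d} (b : VortexIndex N o) :
    Continuous (phase b : Torus N → AddCircle (2 * Real.pi)) := by
  rcases b with a | i
  · exact (continuous_apply a.2).comp (continuous_apply a.1)
  · exact continuous_const

/-- A real representative of the angle of each vortex. -/
def phaseRep {o : Fin d} (ϑ : Torus N) (b : VortexIndex N o) : ℝ :=
  Function.surjInv QuotientAddGroup.mk_surjective (phase b ϑ)

theorem coe_phaseRep {o : Fin d} (ϑ : Torus N) (b : VortexIndex N o) :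
    (phaseRep ϑ b : AddCircle (2 * Real.pi)) = phase b ϑ :=
  Function.surjInv_eq QuotientAddGroup.mk_surjective _

/-- The element of `C^s_div(𝕋^d)` given by a smooth, periodic, divergence-free field. -/
def CDiv.mk (f : E d → E d) (hf : ContDiff ℝ (⊤ : ℕ∞) f) (hp : PeriodicFun f)
    (hdiv : ∀ x, divergence f x = 0) : CDiv s d :=
  ⟨CPer.mk f hf hp, hf.differentiable (by simp), hdiv⟩

namespace VortexLayout

variable (L : VortexLayout N d)

/-- The centre of the slab of a vortex. -/
def center (b : VortexIndex N L.o) : ℝ := slabCenter (L.slot b)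

/-- The squared radius of a vortex. -/
def radiusSq (b : VortexIndex N L.o) : ℝ := slabRadiusSq (L.slot b)

theorem radiusSq_pos (b : VortexIndex N L.o) : 0 < L.radiusSq b := slabRadiusSq_pos _

theorem radiusSq_le (b : VortexIndex N L.o) : L.radiusSq b ≤ 1 / 32 := slabRadiusSq_le _

/-- A vortex of unit amplitude with the given position. -/
def vortexField (s : ℕ) (b : VortexIndex N L.o) (r : ℝ) : CDiv s d :=
  CDiv.mk (vortex L.o (L.dir b) (L.center b) (L.radiusSq b) r) (contDiff_vortex _ _ _ _ _)
    (periodicFun_vortex _ _ _ _ _) (divergence_vortex (L.dir_ne b) _ _ _)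

/-- The shear flow of unit velocity that carries a vortex. -/
def shearField (s : ℕ) (b : VortexIndex N L.o) : CDiv s d :=
  CDiv.mk (shear L.o (L.dir b) (L.center b) (L.radiusSq b)) (contDiff_shear _ _ _ _)
    (periodicFun_shear _ _ _ _) (divergence_shear (L.dir_ne b) _ _)

/-- The pressure of a vortex of unit amplitude. -/
def pressureField (s : ℕ) (b : VortexIndex N L.o) (r : ℝ) : CPer s d ℝ :=
  CPer.mk (vortexPressure L.o (L.dir b) (L.center b) (L.radiusSq b) r)
    (contDiff_vortexPressure _ _ _ _ _) (periodicFun_vortexPressure _ _ _ _ _)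

theorem vortexField_apply (b : VortexIndex N L.o) (r : ℝ) (x : E d) :
    (L.vortexField s b r : CPer s d (E d)) x =
      vortex L.o (L.dir b) (L.center b) (L.radiusSq b) r x := rfl

theorem vortexField_periodic (b : VortexIndex N L.o) :
    Function.Periodic (L.vortexField s b) (2 * Real.pi) := by
  intro r
  refine Subtype.ext (DFunLike.ext _ _ fun x => ?_)
  rw [vortexField_apply, vortexField_apply]
  simp only [vortex, ← sub_sub, well_periodic.sub_eq, well'_periodic.sub_eq]

/-- A vortex of unit amplitude as a function of its angle. -/
def vortexOrbit (s : ℕ) (b : VortexIndex N L.o) : AddCircle (2 * Real.pi) → CDiv s d :=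
  (L.vortexField_periodic b).lift

theorem vortexOrbit_coe (b : VortexIndex N L.o) (r : ℝ) :
    L.vortexOrbit s b r = L.vortexField s b r :=
  (L.vortexField_periodic b).lift_coe r

/-- The vortices depend on their angle in a `C¹` way, and with their pressures they are bounded. -/
theorem exists_bound (hs : 1 ≤ s) (b : VortexIndex N L.o) :
    (∀ r, HasDerivAt (L.vortexField s b) (deriv (L.vortexField s b) r) r) ∧
      Continuous (deriv (L.vortexField s b)) ∧
      ∃ M, ∀ r, ‖L.vortexField s b r‖ ≤ M ∧ ‖deriv (L.vortexField s b) r‖ ≤ M ∧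
        ‖L.pressureField s b r‖ ≤ M := by
  obtain ⟨V', hV', hc, M, hM⟩ := exists_deriv_translate hs
    (contDiff_vortex L.o (L.dir b) (L.center b) (L.radiusSq b) 0) (periodicFun_vortex _ _ _ _ _)
    (L.dir b) (V := L.vortexField s b) fun r x => vortex_eq_translate (L.dir_ne b) _ _ r x
  have he : deriv (L.vortexField s b) = V' := funext fun r => (hV' r).deriv
  rw [he]
  refine ⟨hV', hc, max M ‖L.pressureField s b 0‖, fun r => ⟨(hM r).1.trans (le_max_left _ _),
    (hM r).2.trans (le_max_left _ _), le_trans ?_ (le_max_right _ _)⟩⟩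
  exact CPer.norm_le_of_translate (v := r • basisVec (L.dir b)) fun x =>
    vortexPressure_eq_translate (L.dir_ne b) _ _ r x

/-- Every point lies in at most one slab. -/
theorem exists_slab (x : E d) : ∃ b₀, ∀ b, b ≠ b₀ →
    2 * L.radiusSq b ≤ well (x L.o - L.center b) := by
  by_cases h : ∃ b₀, well (x L.o - L.center b₀) < 2 * L.radiusSq b₀
  · obtain ⟨b₀, hb₀⟩ := h
    exact ⟨b₀, fun b hb => slab_disjoint (L.slot_injective.ne hb.symm) hb₀⟩
  · push Not at h
    have : Nontrivial (Fin d) := Fin.nontrivial_iff_two_le.2 L.two_le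
    obtain ⟨i, hi⟩ := exists_ne L.o
    exact ⟨Sum.inr ⟨i, hi⟩, fun b _ => h b⟩

end VortexLayout

/-- Positive weights that make two given families summable. -/
theorem exists_amplitude {κ : Type*} [Countable κ] (M : κ → ℝ) :
    ∃ A : κ → ℝ, (∀ b, 0 < A b) ∧ Summable (fun b => A b * |M b|) ∧
      Summable fun b => A b ^ 2 * |M b| := by
  have : Encodable κ := Encodable.ofCountable κ
  obtain ⟨w, hw, c, hc, -⟩ := posSumOfEncodable (zero_lt_one' ℝ) κ
  have hA0 : ∀ b, 0 < min (w b) 1 / (1 + |M b|) := fun b =>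
    div_pos (lt_min (hw b) one_pos) (by positivity)
  have h1 : ∀ b, min (w b) 1 / (1 + |M b|) * |M b| ≤ w b := by
    intro b
    rw [div_mul_eq_mul_div, div_le_iff₀ (by positivity)]
    have := min_le_left (w b) 1
    nlinarith [abs_nonneg (M b), hw b]
  have hA1 : ∀ b, min (w b) 1 / (1 + |M b|) ≤ 1 := by
    intro b
    rw [div_le_one (by positivity)]
    linarith [min_le_right (w b) 1, abs_nonneg (M b)]
  refine ⟨_, hA0, Summable.of_nonneg_of_le (fun b => mul_nonneg (hA0 b).le (abs_nonneg _)) h1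
    hc.summable, Summable.of_nonneg_of_le (fun b => by positivity) (fun b => ?_) hc.summable⟩
  refine le_trans ?_ (h1 b)
  refine mul_le_mul_of_nonneg_right ?_ (abs_nonneg _)
  rw [pow_two]
  exact mul_le_of_le_one_left (hA0 b).le (hA1 b)

end Array

section Series

/-! ### Series of functions of infinitely many angles -/

variable {κ T G : Type*} [NormedAddCommGroup T] [NormedSpace ℝ T] [NormedAddCommGroup G]
  [NormedSpace ℝ G]

/-- The derivative of `h ↦ ∑ V_b (r_b + ℓ_b h)` at the origin, where `V' b` is the derivative of
`V b`. -/
def seriesDeriv (ℓ : κ → T →L[ℝ] ℝ) (V' : κ → ℝ → G) (r : κ → ℝ) : T →L[ℝ] G :=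
  ∑' b, (ℓ b).smulRight (V' b (r b))

variable {ℓ : κ → T →L[ℝ] ℝ} {V V' : κ → ℝ → G} {w : κ → ℝ}

theorem norm_smulRight_le (hℓ : ∀ b, ‖ℓ b‖ ≤ 1) (hw : ∀ b r, ‖V' b r‖ ≤ w b) (b : κ) (r : ℝ) :
    ‖(ℓ b).smulRight (V' b r)‖ ≤ w b := by
  rw [ContinuousLinearMap.norm_smulRight_apply]
  exact (mul_le_of_le_one_left (norm_nonneg _) (hℓ b)).trans (hw b r)

theorem norm_seriesDeriv_le (hℓ : ∀ b, ‖ℓ b‖ ≤ 1) (hw : ∀ b r, ‖V' b r‖ ≤ w b)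
    (hs : Summable w) (r : κ → ℝ) : ‖seriesDeriv ℓ V' r‖ ≤ ∑' b, w b :=
  tsum_of_norm_bounded hs.hasSum fun b => norm_smulRight_le hℓ hw b (r b)

variable [CompleteSpace G]

theorem continuous_series {X : Type*} [TopologicalSpace X] {c : κ → G} {a : κ → ℝ} {f : κ → X → G}
    (hf : ∀ b, Continuous (f b)) (hs : Summable w) (hw : ∀ b x, ‖c b + a b • f b x‖ ≤ w b) :
    Continuous fun x => ∑' b, (c b + a b • f b x) :=
  continuous_tsum (fun b => continuous_const.add ((hf b).const_smul (a b))) hs hw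

theorem hasSum_seriesDeriv_apply (hℓ : ∀ b, ‖ℓ b‖ ≤ 1) (hw : ∀ b r, ‖V' b r‖ ≤ w b)
    (hs : Summable w) (r : κ → ℝ) (h : T) :
    HasSum (fun b => ℓ b h • V' b (r b)) (seriesDeriv ℓ V' r h) :=
  (Summable.of_norm_bounded hs
    fun b => norm_smulRight_le hℓ hw b (r b)).hasSum.mapL (ContinuousLinearMap.apply ℝ G h)

theorem hasFDerivAt_series (hℓ : ∀ b, ‖ℓ b‖ ≤ 1) (hV : ∀ b r, HasDerivAt (V b) (V' b r) r)
    (hw : ∀ b r, ‖V' b r‖ ≤ w b) (hs : Summable w) {r : κ → ℝ}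
    (hsum : Summable fun b => V b (r b)) (h : T) :
    HasFDerivAt (fun h => ∑' b, V b (r b + ℓ b h)) (seriesDeriv ℓ V' fun b => r b + ℓ b h) h := by
  refine hasFDerivAt_tsum (f' := fun b h => (ℓ b).smulRight (V' b (r b + ℓ b h))) hs
    (fun b h => ?_) (fun b h => norm_smulRight_le hℓ hw b _) (x₀ := 0) (by simpa using hsum) h
  have h2 : HasFDerivAt (fun h : T => r b + ℓ b h) (ℓ b) h :=
    (ℓ b).hasFDerivAt.const_add (r b)
  refine ((hV b _).hasFDerivAt.comp h h2).congr_fderiv ?_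
  ext1 v
  simp

theorem contDiff_series (hℓ : ∀ b, ‖ℓ b‖ ≤ 1) (hV : ∀ b r, HasDerivAt (V b) (V' b r) r)
    (hVc : ∀ b, Continuous (V' b)) (hw : ∀ b r, ‖V' b r‖ ≤ w b) (hs : Summable w) {r : κ → ℝ}
    (hsum : Summable fun b => V b (r b)) :
    ContDiff ℝ 1 fun h => ∑' b, V b (r b + ℓ b h) := by
  rw [contDiff_one_iff_fderiv]
  refine ⟨fun h => (hasFDerivAt_series hℓ hV hw hs hsum h).differentiableAt, ?_⟩
  rw [funext fun h => (hasFDerivAt_series hℓ hV hw hs hsum h).fderiv]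
  refine continuous_tsum (fun b => ?_) hs fun b h => norm_smulRight_le hℓ hw b _
  exact (ContinuousLinearMap.smulRightL ℝ T G (ℓ b)).continuous.comp
    ((hVc b).comp (continuous_const.add (ℓ b).continuous))

end Series

section Array

variable {N : ℕ → ℕ} {s d : ℕ}

/-- Vortices of given amplitudes, carried by shear flows with velocities given by `ν`, such that
all the series involved converge in `C^s`. -/
structure VortexArray (N : ℕ → ℕ) (s d : ℕ) extends VortexLayout N d where
  one_le : 1 ≤ s
  /-- The frequencies. -/
  ν : Tangent N
  /-- The amplitudes of the vortices. -/
  amp : VortexIndex N o → ℝ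
  amp_pos : ∀ b, 0 < amp b
  /-- Bounds for the vortices, for their derivatives with respect to the angle and for their
  pressures. -/
  bound : VortexIndex N o → ℝ
  norm_vortex_le : ∀ b r, ‖toVortexLayout.vortexField s b r‖ ≤ bound b
  norm_deriv_le : ∀ b r, ‖deriv (toVortexLayout.vortexField s b) r‖ ≤ bound b
  norm_pressure_le : ∀ b r, ‖toVortexLayout.pressureField s b r‖ ≤ bound b
  summable_amp : Summable fun b => amp b * bound b
  summable_amp_sq : Summable fun b => amp b ^ 2 * bound b
  summable_shear : Summable fun b => ‖speed b ν • toVortexLayout.shearField s b‖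

namespace VortexArray

variable (W : VortexArray N s d)

/-- The velocity field, as a function on the torus of the angles. -/
def field (ϑ : Torus N) : CDiv s d :=
  ∑' b, (speed b W.ν • W.shearField s b + W.amp b • W.vortexOrbit s b (phase b ϑ))

/-- The velocity field of one vortex and of the shear flow that carries it. -/
def block (b : VortexIndex N W.o) (r : ℝ) : CDiv s d :=
  speed b W.ν • W.shearField s b + W.amp b • W.vortexField s b r

theorem bound_nonneg (b : VortexIndex N W.o) : 0 ≤ W.bound b :=
  (norm_nonneg _).trans (W.norm_vortex_le b 0)

theorem norm_block_le (b : VortexIndex N W.o) (r : ℝ) :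
    ‖W.block b r‖ ≤ ‖speed b W.ν • W.shearField s b‖ + W.amp b * W.bound b := by
  refine (norm_add_le _ _).trans (add_le_add_right ?_ _)
  rw [norm_smul, Real.norm_of_nonneg (W.amp_pos b).le]
  exact mul_le_mul_of_nonneg_left (W.norm_vortex_le b r) (W.amp_pos b).le

theorem summable_bound :
    Summable fun b => ‖speed b W.ν • W.shearField s b‖ + W.amp b * W.bound b :=
  W.summable_shear.add W.summable_amp

theorem field_eq {ϑ : Torus N} {r : VortexIndex N W.o → ℝ}
    (hr : ∀ b, (r b : AddCircle (2 * Real.pi)) = phase b ϑ) :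
    W.field ϑ = ∑' b, W.block b (r b) :=
  tsum_congr fun b => by rw [← hr b, VortexLayout.vortexOrbit_coe, block]

theorem hasSum_block (r : VortexIndex N W.o → ℝ) :
    HasSum (fun b => W.block b (r b)) (∑' b, W.block b (r b)) := by
  have := completeSpace_CDiv (d := d) W.one_le
  exact (Summable.of_norm_bounded W.summable_bound fun b => W.norm_block_le b (r b)).hasSum

theorem block_apply (b : VortexIndex N W.o) (r : ℝ) (x : E d) :
    (W.block b r : CPer s d (E d)) x =
      speed b W.ν • shear W.o (W.dir b) (W.center b) (W.radiusSq b) x +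
        W.amp b • vortex W.o (W.dir b) (W.center b) (W.radiusSq b) r x := rfl

theorem fderiv_block (b : VortexIndex N W.o) (r : ℝ) (x : E d) :
    fderiv ℝ (W.block b r : CPer s d (E d)) x =
      speed b W.ν • fderiv ℝ (shear W.o (W.dir b) (W.center b) (W.radiusSq b)) x +
        W.amp b • fderiv ℝ (vortex W.o (W.dir b) (W.center b) (W.radiusSq b) r) x := by
  have h1 := (contDiff_shear W.o (W.dir b) (W.center b) (W.radiusSq b)).differentiable
    (by simp) x
  have h2 := (contDiff_vortex W.o (W.dir b) (W.center b) (W.radiusSq b) r).differentiable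
    (by simp) x
  exact ((h1.hasFDerivAt.const_smul (speed b W.ν)).add
    (h2.hasFDerivAt.const_smul (W.amp b))).fderiv

theorem radiusSq_le_of_off {b : VortexIndex N W.o} {x : E d}
    (h : 2 * W.radiusSq b ≤ well (x W.o - W.center b)) (r : ℝ) :
    W.radiusSq b ≤ well (x W.o - W.center b) + well (x (W.dir b) - r) := by
  linarith [W.radiusSq_pos b, well_nonneg (x (W.dir b) - r)]

theorem block_apply_eq_zero {b : VortexIndex N W.o} {x : E d}
    (h : 2 * W.radiusSq b ≤ well (x W.o - W.center b)) (r : ℝ) :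
    (W.block b r : CPer s d (E d)) x = 0 := by
  rw [block_apply, shear_eq_zero (W.radiusSq_pos b) h,
    vortex_eq_zero (W.radiusSq_le_of_off h r), smul_zero, smul_zero, add_zero]

theorem fderiv_block_eq_zero {b : VortexIndex N W.o} {x : E d}
    (h : 2 * W.radiusSq b ≤ well (x W.o - W.center b)) (r : ℝ) :
    fderiv ℝ (W.block b r : CPer s d (E d)) x = 0 := by
  rw [fderiv_block, fderiv_shear_eq_zero (W.radiusSq_pos b) h,
    fderiv_vortex_eq_zero (W.radiusSq_le_of_off h r)]
  ext1 v
  simp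

/-! ### The field in a slab -/

theorem hasSum_field_apply {ϑ : Torus N} {r : VortexIndex N W.o → ℝ}
    (hr : ∀ b, (r b : AddCircle (2 * Real.pi)) = phase b ϑ) (x : E d) :
    HasSum (fun b => (W.block b (r b) : CPer s d (E d)) x)
      ((W.field ϑ : CPer s d (E d)) x) := by
  rw [W.field_eq hr]
  exact (W.hasSum_block r).mapL ((CPer.evalL x).comp (CDiv s d).subtypeL)

theorem hasSum_fderiv_field {ϑ : Torus N} {r : VortexIndex N W.o → ℝ}
    (hr : ∀ b, (r b : AddCircle (2 * Real.pi)) = phase b ϑ) (x : E d) :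
    HasSum (fun b => fderiv ℝ (W.block b (r b) : CPer s d (E d)) x)
      (fderiv ℝ (W.field ϑ : CPer s d (E d)) x) := by
  rw [W.field_eq hr]
  exact (W.hasSum_block r).mapL ((CPer.fderivL W.one_le x).comp (CDiv s d).subtypeL)

theorem field_apply {ϑ : Torus N} {r : VortexIndex N W.o → ℝ}
    (hr : ∀ b, (r b : AddCircle (2 * Real.pi)) = phase b ϑ) {x : E d} {b₀ : VortexIndex N W.o}
    (hb : ∀ b, b ≠ b₀ → 2 * W.radiusSq b ≤ well (x W.o - W.center b)) :
    (W.field ϑ : CPer s d (E d)) x = (W.block b₀ (r b₀) : CPer s d (E d)) x :=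
  (W.hasSum_field_apply hr x).unique
    (hasSum_single b₀ fun b hne => W.block_apply_eq_zero (hb b hne) (r b))

theorem field_apply_eq_zero (ϑ : Torus N) {x : E d} (hx : x W.o = 0) :
    (W.field ϑ : CPer s d (E d)) x = 0 := by
  refine (W.hasSum_field_apply (coe_phaseRep ϑ) x).unique ?_
  convert! (hasSum_zero : HasSum (fun _ : VortexIndex N W.o => (0 : E d)) 0) using 2 with b
  refine W.block_apply_eq_zero ?_ _
  rw [hx]
  exact zero_not_mem_slab _

theorem fderiv_field {ϑ : Torus N} {r : VortexIndex N W.o → ℝ}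
    (hr : ∀ b, (r b : AddCircle (2 * Real.pi)) = phase b ϑ) {x : E d} {b₀ : VortexIndex N W.o}
    (hb : ∀ b, b ≠ b₀ → 2 * W.radiusSq b ≤ well (x W.o - W.center b)) :
    fderiv ℝ (W.field ϑ : CPer s d (E d)) x =
      fderiv ℝ (W.block b₀ (r b₀) : CPer s d (E d)) x :=
  (W.hasSum_fderiv_field hr x).unique
    (hasSum_single b₀ fun b hne => W.fderiv_block_eq_zero (hb b hne) (r b))

/-! ### Differentiability with respect to the angles -/

/-- The derivative of `block` with respect to the angle. -/
def blockDeriv (b : VortexIndex N W.o) (r : ℝ) : CDiv s d :=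
  W.amp b • deriv (W.vortexField s b) r

theorem hasDerivAt_block (b : VortexIndex N W.o) (r : ℝ) :
    HasDerivAt (W.block b) (W.blockDeriv b r) r :=
  (((W.exists_bound W.one_le b).1 r).const_smul (W.amp b)).const_add _

theorem continuous_blockDeriv (b : VortexIndex N W.o) : Continuous (W.blockDeriv b) :=
  (W.exists_bound W.one_le b).2.1.const_smul (W.amp b)

theorem norm_blockDeriv_le (b : VortexIndex N W.o) (r : ℝ) :
    ‖W.blockDeriv b r‖ ≤ W.amp b * W.bound b := by
  rw [blockDeriv, norm_smul, Real.norm_of_nonneg (W.amp_pos b).le]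
  exact mul_le_mul_of_nonneg_left (W.norm_deriv_le b _) (W.amp_pos b).le

theorem field_add_toTorus {ϑ : Torus N} {r : VortexIndex N W.o → ℝ}
    (hr : ∀ b, (r b : AddCircle (2 * Real.pi)) = phase b ϑ) :
    (fun h : Tangent N => W.field (ϑ + toTorus h)) =
      fun h => ∑' b, W.block b (r b + speed b h) := by
  funext h
  refine W.field_eq fun b => ?_
  rw [phase_add_toTorus, ← hr b]
  rfl

theorem hasFDerivAt_field {ϑ : Torus N} {r : VortexIndex N W.o → ℝ}
    (hr : ∀ b, (r b : AddCircle (2 * Real.pi)) = phase b ϑ) (h : Tangent N) :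
    HasFDerivAt (fun h : Tangent N => W.field (ϑ + toTorus h))
      (seriesDeriv speed W.blockDeriv fun b => r b + speed b h) h := by
  have := completeSpace_CDiv (d := d) W.one_le
  rw [W.field_add_toTorus hr]
  exact hasFDerivAt_series norm_speed_le W.hasDerivAt_block W.norm_blockDeriv_le W.summable_amp
    (W.hasSum_block r).summable h

theorem dTorus_field {ϑ : Torus N} {r : VortexIndex N W.o → ℝ}
    (hr : ∀ b, (r b : AddCircle (2 * Real.pi)) = phase b ϑ) :
    dTorus W.field ϑ = seriesDeriv speed W.blockDeriv r := by
  have h := (W.hasFDerivAt_field hr 0).fderiv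
  simp only [map_zero, add_zero] at h
  exact h

theorem isC1_field : IsC1 W.field := by
  intro ϑ
  have := completeSpace_CDiv (d := d) W.one_le
  rw [W.field_add_toTorus (coe_phaseRep ϑ)]
  exact contDiff_series norm_speed_le W.hasDerivAt_block W.continuous_blockDeriv
    W.norm_blockDeriv_le W.summable_amp (W.hasSum_block _).summable

theorem supSeminorm_le {n : ℕ} (hn : n ≤ s) (f : CPer s d (E d)) : supSeminorm n f ≤ ‖f‖ :=
  Real.iSup_le (fun x => Real.iSup_le (fun σ => f.norm_pderiv_le hn σ x) (norm_nonneg _))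
    (norm_nonneg _)

theorem isC1b_field : IsC1b W.field := by
  refine ⟨W.isC1_field, fun n hn => ?_⟩
  set C₁ := ∑' b, (‖speed b W.ν • W.shearField s b‖ + W.amp b * W.bound b)
  set C₂ := ∑' b, W.amp b * W.bound b
  have h2 : 0 ≤ C₂ := tsum_nonneg fun b => mul_nonneg (W.amp_pos b).le (W.bound_nonneg b)
  have h1 : 0 ≤ C₁ := tsum_nonneg fun b =>
    add_nonneg (norm_nonneg _) (mul_nonneg (W.amp_pos b).le (W.bound_nonneg b))
  refine ⟨C₁ + C₂ + 1, by linarith, fun ϑ => ?_, fun ϑ h => ?_⟩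
  · refine (supSeminorm_le hn _).trans (le_trans ?_ (by linarith : C₁ ≤ C₁ + C₂ + 1))
    rw [W.field_eq (coe_phaseRep ϑ)]
    exact tsum_of_norm_bounded (f := fun b => W.block b (phaseRep ϑ b)) W.summable_bound.hasSum
      fun b => W.norm_block_le b (phaseRep ϑ b)
  · refine (supSeminorm_le hn _).trans ?_
    rw [W.dTorus_field (coe_phaseRep ϑ)]
    refine ((seriesDeriv speed W.blockDeriv (phaseRep ϑ)).le_opNorm h).trans
      (mul_le_mul_of_nonneg_right ?_ (norm_nonneg h))
    exact (norm_seriesDeriv_le norm_speed_le W.norm_blockDeriv_le W.summable_amp _).trans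
      (by linarith)

theorem blockDeriv_apply (b : VortexIndex N W.o) (r : ℝ) (x : E d) :
    (W.blockDeriv b r : CPer s d (E d)) x = W.amp b • -fderiv ℝ (vortex W.o (W.dir b)
      (W.center b) (W.radiusSq b) r) x (basisVec (W.dir b)) := by
  have h1 := ((CPer.evalL x).comp (CDiv s d).subtypeL).hasFDerivAt.comp_hasDerivAt r
      ((W.exists_bound W.one_le b).1 r)
  have h2 := h1.unique (hasDerivAt_vortex (W.dir_ne b) (W.center b) (W.radiusSq b) r x)
  rw [← h2]
  rfl

/-- In a slab, the derivative with respect to the angles only sees the vortex of that slab. -/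
theorem dTorus_field_apply {ϑ : Torus N} {r : VortexIndex N W.o → ℝ}
    (hr : ∀ b, (r b : AddCircle (2 * Real.pi)) = phase b ϑ) (h : Tangent N) {x : E d}
    {b₀ : VortexIndex N W.o}
    (hb : ∀ b, b ≠ b₀ → 2 * W.radiusSq b ≤ well (x W.o - W.center b)) :
    (dTorus W.field ϑ h : CPer s d (E d)) x =
      speed b₀ h • (W.blockDeriv b₀ (r b₀) : CPer s d (E d)) x := by
  have := completeSpace_CDiv (d := d) W.one_le
  rw [W.dTorus_field hr]
  have h1 := (hasSum_seriesDeriv_apply norm_speed_le W.norm_blockDeriv_le W.summable_amp r h).mapL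
    ((CPer.evalL x).comp (CDiv s d).subtypeL)
  refine h1.unique (hasSum_single b₀ fun b hne => ?_)
  change speed b h • (W.blockDeriv b (r b) : CPer s d (E d)) x = 0
  rw [blockDeriv_apply, fderiv_vortex_eq_zero (W.radiusSq_le_of_off (hb b hne) (r b)), zero_apply,
    neg_zero, smul_zero, smul_zero]

end VortexArray

end Array

section Array

variable {N : ℕ → ℕ} {s d : ℕ}

namespace VortexArray

variable (W : VortexArray N s d)

/-! ### The pressure -/

/-- The pressure, up to a constant. -/
def rawPressure (ϑ : Torus N) : CPer s d ℝ :=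
  ∑' b, W.amp b ^ 2 • W.pressureField s b (phaseRep ϑ b)

/-- The pressure, as a function on the torus of the angles. -/
def pressure (ϑ : Torus N) : CPer s d ℝ :=
  W.rawPressure ϑ - CPer.mk (fun _ => ((2 * Real.pi) ^ d)⁻¹ * ∫ y in cell d, W.rawPressure ϑ y)
    contDiff_const fun _ _ => rfl

theorem integral_pressure (ϑ : Torus N) : ∫ x in cell d, W.pressure ϑ x = 0 := by
  have h1 : MeasureTheory.IntegrableOn (W.rawPressure ϑ) (cell d) :=
    integrableOn_cell (W.rawPressure ϑ).contDiff.continuous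
  have h2 : MeasureTheory.IntegrableOn (fun _ : E d => ((2 * Real.pi) ^ d)⁻¹ *
    ∫ y in cell d, W.rawPressure ϑ y) (cell d) := integrableOn_cell continuous_const
  change ∫ x in cell d, (W.rawPressure ϑ x -
    ((2 * Real.pi) ^ d)⁻¹ * ∫ y in cell d, W.rawPressure ϑ y) = 0
  rw [MeasureTheory.integral_sub h1 h2, MeasureTheory.setIntegral_const,
    volume_real_cell, smul_eq_mul, mul_inv_cancel_left₀ (by positivity), sub_self]

theorem hasSum_fderiv_rawPressure (ϑ : Torus N) (x : E d) :
    HasSum (fun b => W.amp b ^ 2 • fderiv ℝ (vortexPressure W.o (W.dir b) (W.center b)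
      (W.radiusSq b) (phaseRep ϑ b)) x) (fderiv ℝ (W.rawPressure ϑ) x) := by
  have h1 : Summable fun b => W.amp b ^ 2 • W.pressureField s b (phaseRep ϑ b) := by
    refine Summable.of_norm_bounded W.summable_amp_sq fun b => ?_
    rw [norm_smul, Real.norm_of_nonneg (by positivity)]
    exact mul_le_mul_of_nonneg_left (W.norm_pressure_le b _) (by positivity)
  have h2 := h1.hasSum.mapL (CPer.fderivL W.one_le x)
  simp only [map_smul] at h2
  exact h2

theorem fderiv_vortexPressure_eq_zero {o i : Fin d} {c R r : ℝ} {x : E d}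
    (h : R ≤ well (x o - c) + well (x i - r)) : fderiv ℝ (vortexPressure o i c R r) x = 0 := by
  have := gradient_vortexPressure o i c R r x
  rw [expNegInvGlue.zero_of_nonpos (by linarith)] at this
  simpa [gradient] using this

theorem gradient_pressure (ϑ : Torus N) {x : E d} {b₀ : VortexIndex N W.o}
    (hb : ∀ b, b ≠ b₀ → 2 * W.radiusSq b ≤ well (x W.o - W.center b)) :
    gradient (W.pressure ϑ) x = W.amp b₀ ^ 2 • gradient (vortexPressure W.o (W.dir b₀)
      (W.center b₀) (W.radiusSq b₀) (phaseRep ϑ b₀)) x := by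
  have h1 : fderiv ℝ (W.pressure ϑ) x = fderiv ℝ (W.rawPressure ϑ) x :=
    fderiv_sub_const _
  have h2 := (W.hasSum_fderiv_rawPressure ϑ x).unique (hasSum_single b₀ fun b hne => by
    rw [fderiv_vortexPressure_eq_zero (W.radiusSq_le_of_off (hb b hne) _), smul_zero])
  unfold gradient
  rw [h1, h2]
  exact map_smul (InnerProductSpace.toDual ℝ (E d)).symm (W.amp b₀ ^ 2) _

/-! ### The Euler equations -/

/-- The Euler equations on the torus of the angles. -/
theorem euler (ϑ : Torus N) (x : E d) :
    (dTorus W.field ϑ W.ν : CPer s d (E d)) x +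
      convect (W.field ϑ : CPer s d (E d)) (W.field ϑ : CPer s d (E d)) x +
      gradient (W.pressure ϑ) x = 0 := by
  obtain ⟨b₀, hb⟩ := W.exists_slab x
  have hr := coe_phaseRep (o := W.o) ϑ
  unfold convect
  rw [W.dTorus_field_apply hr W.ν hb, W.gradient_pressure ϑ hb, W.field_apply hr hb,
    W.fderiv_field hr hb, fderiv_block, block_apply, blockDeriv_apply, smul_smul,
    mul_comm (speed b₀ W.ν)]
  exact block_euler (W.dir_ne b₀) _ _ _ _ (W.radiusSq_pos b₀)
    ((W.radiusSq_le b₀).trans (by norm_num)) x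

theorem isInvNegLaplacianDiv_pressure (ϑ : Torus N) :
    IsInvNegLaplacianDiv (convect (W.field ϑ : CPer s d (E d)) (W.field ϑ : CPer s d (E d)))
      (W.pressure ϑ) :=
  isInvNegLaplacianDiv_of_euler W.one_le (W.euler ϑ) (W.integral_pressure ϑ)

theorem hasDerivAt_field_time (θ : Torus N) (t : ℝ) :
    HasDerivAt (fun τ : ℝ => W.field (θ + toTorus (τ • W.ν)))
      (dTorus W.field (θ + toTorus (t • W.ν)) W.ν) t := by
  have h1 := W.hasFDerivAt_field (coe_phaseRep θ) (t • W.ν)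
  have h2 : HasDerivAt (fun τ : ℝ => τ • W.ν) W.ν t := by
    simpa using (hasDerivAt_id t).smul_const W.ν
  have h3 := h1.comp_hasDerivAt t h2
  rwa [← W.dTorus_field (ϑ := θ + toTorus (t • W.ν))] at h3
  intro b
  rw [phase_add_toTorus, ← coe_phaseRep θ b]
  rfl

theorem isEulerSolution (θ : Torus N) :
    IsEulerSolution
      (fun t => ((W.field (θ + toTorus (t • W.ν)) : CPer s d (E d)) : E d → E d))
      (fun t => W.pressure (θ + toTorus (t • W.ν))) := by
  refine ⟨fun t => ⟨CPer.periodic _, CPer.periodic _⟩, fun t x => ?_⟩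
  have h : HasDerivAt (fun τ : ℝ => (W.field (θ + toTorus (τ • W.ν)) : CPer s d (E d)) x)
      ((dTorus W.field (θ + toTorus (t • W.ν)) W.ν : CPer s d (E d)) x) t :=
    ((CPer.evalL x).comp (CDiv s d).subtypeL).hasFDerivAt.comp_hasDerivAt t
      (W.hasDerivAt_field_time θ t)
  refine ⟨h.differentiableAt, (W.field _).2.1 x, CPer.differentiable W.one_le _ x, ?_,
    (W.field _).2.2 x⟩
  rw [h.deriv]
  exact W.euler _ x

/-! ### The embedding property -/

theorem continuous_vortexOrbit (b : VortexIndex N W.o) : Continuous (W.vortexOrbit s b) := by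
  rw [(isQuotientMap_quotient_mk' (s := QuotientAddGroup.leftRel
    (AddSubgroup.zmultiples (2 * Real.pi)))).continuous_iff]
  exact continuous_iff_continuousAt.2 fun r => ((W.exists_bound W.one_le b).1 r).continuousAt

theorem continuous_field : Continuous W.field := by
  have := completeSpace_CDiv (d := d) W.one_le
  have h3 : ∀ (b : VortexIndex N W.o) (ϑ : Torus N),
      ‖speed b W.ν • W.shearField s b + W.amp b • W.vortexOrbit s b (phase b ϑ)‖ ≤
        ‖speed b W.ν • W.shearField s b‖ + W.amp b * W.bound b := by
    intro b ϑ
    have := W.norm_block_le b (phaseRep ϑ b)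
    rwa [block, ← VortexLayout.vortexOrbit_coe, coe_phaseRep] at this
  exact continuous_series (c := fun b => speed b W.ν • W.shearField s b)
    (fun b => (W.continuous_vortexOrbit b).comp (continuous_phase b)) W.summable_bound h3

/-- The point with the given coordinates along the axis and along the direction of a vortex. -/
def point (b : VortexIndex N W.o) (y z : ℝ) : E d :=
  y • basisVec W.o + z • basisVec (W.dir b)

theorem point_o (b : VortexIndex N W.o) (y z : ℝ) : W.point b y z W.o = y := by
  simp [point, basisVec_ne (W.dir_ne b).symm]

theorem point_dir (b : VortexIndex N W.o) (y z : ℝ) : W.point b y z (W.dir b) = z := by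
  simp [point, basisVec_ne (W.dir_ne b)]

theorem abs_lt_of_sq_lt_radiusSq {b : VortexIndex N W.o} {δ : ℝ} (h : δ ^ 2 < W.radiusSq b) :
    |δ| < 1 / 2 := by
  refine abs_lt_of_sq_lt_sq (h.trans_le ((W.radiusSq_le b).trans ?_)) (by norm_num)
  norm_num

theorem off_of_sq_lt {b₀ : VortexIndex N W.o} {x : E d}
    (h : well (x W.o - W.center b₀) < 2 * W.radiusSq b₀) :
    ∀ b, b ≠ b₀ → 2 * W.radiusSq b ≤ well (x W.o - W.center b) :=
  fun _ hb => slab_disjoint (W.slot_injective.ne hb.symm) h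

/-- If two configurations give the same field, then each vortex has the same positions in both:
otherwise, on a line at distance `δ` from the centre, with `δ` close to the radius, only one of
the two vortices would be seen. -/
theorem well_sub_eq_zero {ϑ ϑ' : Torus N} (h : W.field ϑ = W.field ϑ')
    (b : VortexIndex N W.o) : well (phaseRep ϑ b - phaseRep ϑ' b) = 0 := by
  refine le_antisymm (le_of_forall_pos_lt_add fun η hη => ?_) (well_nonneg _)
  have hR := W.radiusSq_pos b
  obtain ⟨δ, hδ0, hδR, hδη⟩ : ∃ δ : ℝ, 0 < δ ∧ δ ^ 2 < W.radiusSq b ∧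
      W.radiusSq b < δ ^ 2 + η := by
    refine ⟨√(W.radiusSq b - min (η / 2) (W.radiusSq b / 2)), Real.sqrt_pos.2 ?_, ?_, ?_⟩
    · linarith [min_le_right (η / 2) (W.radiusSq b / 2)]
    · rw [Real.sq_sqrt (by linarith [min_le_right (η / 2) (W.radiusSq b / 2)])]
      have : 0 < min (η / 2) (W.radiusSq b / 2) := lt_min (by linarith) (by linarith)
      linarith
    · rw [Real.sq_sqrt (by linarith [min_le_right (η / 2) (W.radiusSq b / 2)])]
      linarith [min_le_left (η / 2) (W.radiusSq b / 2)]
  have hδ := W.abs_lt_of_sq_lt_radiusSq hδR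
  set x : E d := W.point b (W.center b + δ) (phaseRep ϑ b) with hx
  have hxo : x W.o - W.center b = δ := by rw [hx, point_o]; ring
  have hw : well (x W.o - W.center b) = δ ^ 2 := by rw [hxo, well_eq_sq hδ.le]
  have hoff := W.off_of_sq_lt (b₀ := b) (x := x) (by rw [hw]; linarith)
  have hval : ∀ ϑ, (W.field ϑ : CPer s d (E d)) x (W.dir b) =
      speed b W.ν * Real.smoothTransition (2 - δ ^ 2 / W.radiusSq b) - W.amp b *
        (expNegInvGlue (W.radiusSq b - (δ ^ 2 + well (x (W.dir b) - phaseRep ϑ b))) *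
          (2 * δ)) := by
    intro ϑ
    rw [W.field_apply (coe_phaseRep ϑ) hoff, block_apply]
    simp only [vortex, shear, hxo, well_eq_sq hδ.le, PiLp.add_apply, PiLp.smul_apply, PiLp.sub_apply,
      basisVec_self, basisVec_ne (W.dir_ne b), smul_eq_mul, well'_of_abs_lt hδ]
    ring
  have heq := hval ϑ
  rw [h, hval ϑ', hx, point_dir, sub_self, well_zero, add_zero] at heq
  have hpos := expNegInvGlue.pos_of_pos (sub_pos.2 hδR)
  have hA := W.amp_pos b
  have h1 : expNegInvGlue (W.radiusSq b - (δ ^ 2 + well (phaseRep ϑ b - phaseRep ϑ' b))) =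
      expNegInvGlue (W.radiusSq b - δ ^ 2) := by
    have h2 := sub_right_inj.1 heq
    exact mul_right_cancel₀ (by positivity) (mul_left_cancel₀ hA.ne' h2)
  by_contra! hcon
  rw [expNegInvGlue.zero_of_nonpos (by linarith)] at h1
  exact hpos.ne h1

theorem injective_field : Function.Injective W.field := by
  intro ϑ ϑ' h
  funext k i
  have h0 := W.well_sub_eq_zero h (Sum.inl ⟨k, i⟩)
  obtain ⟨n, hn⟩ := well_eq_zero_iff.1 h0
  have h1 : (phaseRep ϑ (Sum.inl ⟨k, i⟩ : VortexIndex N W.o) : AddCircle (2 * Real.pi)) =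
      phaseRep ϑ' (Sum.inl ⟨k, i⟩ : VortexIndex N W.o) := by
    rw [← sub_eq_zero, ← AddCircle.coe_sub, hn, AddCircle.coe_eq_zero_iff]
    exact ⟨n, by simp⟩
  rw [coe_phaseRep, coe_phaseRep] at h1
  exact h1

theorem injective_dTorus_field (ϑ : Torus N) : Function.Injective (dTorus W.field ϑ) := by
  rw [injective_iff_map_eq_zero]
  intro h h0
  ext k i
  set b : VortexIndex N W.o := Sum.inl ⟨k, i⟩
  set x : E d := W.point b (W.center b) (phaseRep ϑ b) with hx
  have hxo : x W.o - W.center b = 0 := by rw [hx, point_o]; ring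
  have hxi : x (W.dir b) - phaseRep ϑ b = 0 := by rw [hx, point_dir]; ring
  have hR := W.radiusSq_pos b
  have hoff := W.off_of_sq_lt (b₀ := b) (x := x) (by rw [hxo, well_zero]; linarith)
  have h1 := W.dTorus_field_apply (coe_phaseRep ϑ) h hoff
  rw [h0, blockDeriv_apply, fderiv_vortex] at h1
  have h2 := congrArg (fun v : E d => v W.o) h1
  have hw : well 0 < 1 / 4 := by rw [well_zero]; norm_num
  simp only [hxo, hxi, PiLp.smul_apply, PiLp.neg_apply, PiLp.add_apply, basisVec_self,
    basisVec_ne (W.dir_ne b).symm, well_zero, well'_of_abs_lt (t := 0) (by norm_num),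
    well''_eq_two hw, smul_eq_mul] at h2
  have h3 : (0 : ℝ) = speed b h * (W.amp b * -(expNegInvGlue (W.radiusSq b) * 2)) := by
    simpa [CPer.coe_zero] using h2
  have hg := expNegInvGlue.pos_of_pos hR
  have hA := W.amp_pos b
  rcases mul_eq_zero.1 h3.symm with h4 | h4
  · exact h4
  · nlinarith [mul_pos hA hg]

theorem isEmb_field : IsEmb W.field := by
  have : Fact (0 < 2 * Real.pi) := ⟨Real.two_pi_pos⟩
  exact ⟨(W.continuous_field.isClosedEmbedding W.injective_field).isEmbedding,
    W.injective_dTorus_field⟩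

/-! ### Absence of symmetries -/

/-- The component of the field along the axis, on the line through the centre of a vortex. -/
theorem field_o_apply (ϑ : Torus N) (b : VortexIndex N W.o) {x : E d}
    (hx : x W.o = W.center b) : (W.field ϑ : CPer s d (E d)) x W.o =
      W.amp b * (expNegInvGlue (W.radiusSq b - well (x (W.dir b) - phaseRep ϑ b)) *
        well' (x (W.dir b) - phaseRep ϑ b)) := by
  have hR := W.radiusSq_pos b
  have hoff := W.off_of_sq_lt (b₀ := b) (x := x) (by rw [hx, sub_self, well_zero]; linarith)
  rw [W.field_apply (coe_phaseRep ϑ) hoff, block_apply]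
  simp [vortex, shear, hx, basisVec_ne (W.dir_ne b).symm, well_zero]

theorem nonSymmetric_field : NonSymmetric W.field := by
  intro ϑ e he hinv
  have key : ∀ b : VortexIndex N W.o, ∃ x : E d, x W.o = W.center b ∧
      (W.field ϑ : CPer s d (E d)) x W.o ≠ 0 := by
    intro b
    have hR := W.radiusSq_pos b
    have hδR : (W.radiusSq b) ^ 2 < W.radiusSq b := by nlinarith [W.radiusSq_le b]
    have hδ := W.abs_lt_of_sq_lt_radiusSq hδR
    refine ⟨W.point b (W.center b) (phaseRep ϑ b + W.radiusSq b), W.point_o _ _ _, ?_⟩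
    rw [W.field_o_apply ϑ b (W.point_o _ _ _), point_dir, add_sub_cancel_left,
      well_eq_sq hδ.le, well'_of_abs_lt hδ]
    have hg := expNegInvGlue.pos_of_pos (sub_pos.2 hδR)
    have hA := W.amp_pos b
    positivity
  by_cases heo : e W.o = 0
  · -- The translations preserve each slab, and move a vortex at rest along its slab.
    obtain ⟨i, hi⟩ : ∃ i, e i ≠ 0 := by
      by_contra! h
      exact he (by ext i; simp [h i])
    have hio : i ≠ W.o := by
      rintro rfl
      exact hi heo
    set b : VortexIndex N W.o := Sum.inr ⟨i, hio⟩
    have hdir : W.dir b = i := W.dir_inr ⟨i, hio⟩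
    obtain ⟨x, hx, hne⟩ := key b
    apply hne
    rw [← hinv ((phaseRep ϑ b - x i) / e i) x, W.field_o_apply ϑ b (by simp [hx, heo]), hdir]
    have : (x + ((phaseRep ϑ b - x i) / e i) • e) i - phaseRep ϑ b = 0 := by
      simp [hi]
    rw [this, well'_of_abs_lt (by norm_num)]
    simp
  · -- The translations take every point to a plane where the field vanishes.
    have : Nontrivial (Fin d) := Fin.nontrivial_iff_two_le.2 W.two_le
    obtain ⟨i, hi⟩ := exists_ne W.o
    obtain ⟨x, hx, hne⟩ := key (Sum.inr ⟨i, hi⟩)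
    apply hne
    rw [← hinv (-x W.o / e W.o) x, W.field_apply_eq_zero ϑ (by simp [heo])]
    rfl

end VortexArray

end Array

section ShearBound

variable {d : ℕ}

/-! ### The size of the shear flows -/

theorem exists_bound_smoothTransition (n : ℕ) :
    ∃ C, ∀ i ≤ n, ∀ y ≤ 2, ‖iteratedFDeriv ℝ i Real.smoothTransition y‖ ≤ C := by
  have h : ∀ i, ∃ C, ∀ y ≤ 2, ‖iteratedFDeriv ℝ i Real.smoothTransition y‖ ≤ C := by
    intro i
    have hc : Continuous (iteratedFDeriv ℝ i Real.smoothTransition) :=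
      (Real.smoothTransition.contDiff (n := i)).continuous_iteratedFDeriv (by simp)
    obtain ⟨C, hC⟩ := (isCompact_Icc (a := (0 : ℝ)) (b := 2)).exists_bound_of_continuousOn
      hc.continuousOn
    refine ⟨C, fun y hy => ?_⟩
    rcases le_or_gt 0 y with h0 | h0
    · exact hC y ⟨h0, hy⟩
    · have he : Real.smoothTransition =ᶠ[nhds y] fun _ => 0 := by
        filter_upwards [gt_mem_nhds h0] with z hz using
          Real.smoothTransition.zero_of_nonpos hz.le
      have h2 : iteratedFDeriv ℝ i (fun _ : ℝ => (0 : ℝ)) = 0 := iteratedFDeriv_fun_zero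
      rw [(he.iteratedFDeriv ℝ i).eq_of_nhds, h2, Pi.zero_apply, norm_zero]
      exact (norm_nonneg _).trans (hC 0 ⟨le_rfl, zero_le_two⟩)
  choose C hC using h
  refine ⟨∑ i ∈ Finset.range (n + 1), |C i|, fun i hi y hy => ?_⟩
  exact (hC i y hy).trans ((le_abs_self _).trans (Finset.single_le_sum (f := fun i => |C i|)
    (fun _ _ => abs_nonneg _) (Finset.mem_range.2 (by omega))))

theorem exists_bound_well (o : Fin d) (n : ℕ) :
    ∃ B, 1 ≤ B ∧ ∀ i ≤ n, ∀ x, ‖iteratedFDeriv ℝ i (fun x : E d => well (x o)) x‖ ≤ B := by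
  have hcd : ContDiff ℝ (⊤ : ℕ∞) fun x : E d => well (x o) := contDiff_well.comp (contDiff_coord o)
  have hp : PeriodicFun fun x : E d => well (x o) :=
    periodicFun_of_coords (o := o) (i := o) (g := fun y _ => well y) (fun _ => well_periodic)
      (fun _ _ => rfl) fun _ => rfl
  have h : ∀ i : ℕ, ∃ C, ∀ x, ‖iteratedFDeriv ℝ i (fun x : E d => well (x o)) x‖ ≤ C := by
    intro i
    refine PeriodicFun.bounded (fun j x => ?_)
      (hcd.continuous_iteratedFDeriv (by exact_mod_cast le_top))
    rw [← iteratedFDeriv_comp_add_right]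
    congr 1
    exact funext fun y => hp j y
  choose C hC using h
  refine ⟨1 + ∑ i ∈ Finset.range (n + 1), |C i|, ?_, fun i hi x => ?_⟩
  · exact le_add_of_nonneg_right (Finset.sum_nonneg fun _ _ => abs_nonneg _)
  · refine (hC i x).trans ((le_abs_self _).trans ?_)
    have := Finset.single_le_sum (f := fun i => |C i|) (fun _ _ => abs_nonneg _)
      (Finset.mem_range.2 (by omega : i < n + 1))
    linarith

/-- The `C^s` norm of the shear flow is at most of the order of `R⁻ˢ`. -/
theorem exists_norm_shear_le (o : Fin d) (s : ℕ) :
    ∃ K, 0 ≤ K ∧ ∀ (i : Fin d) (c R : ℝ), 0 < R → R ≤ 1 → ∀ n ≤ s, ∀ (σ : Fin n → Fin d) (x : E d),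
      ‖pderiv σ (shear o i c R) x‖ ≤ K * R⁻¹ ^ s := by
  obtain ⟨C, hC⟩ := exists_bound_smoothTransition s
  obtain ⟨B, hB1, hB⟩ := exists_bound_well o s
  have hC0 : 0 ≤ C := (norm_nonneg _).trans (hC 0 (Nat.zero_le _) 0 zero_le_two)
  refine ⟨s.factorial * C * B ^ s, by positivity, fun i c R hR hR1 n hn σ x => ?_⟩
  have hR1' : 1 ≤ R⁻¹ := (one_le_inv₀ hR).2 hR1
  have hBR : 1 ≤ B * R⁻¹ := one_le_mul_of_one_le_of_one_le hB1 hR1'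
  have hF' : ContDiff ℝ (⊤ : ℕ∞) fun x : E d => well (x o - c) :=
    contDiff_well.comp ((contDiff_coord o).sub contDiff_const)
  have hFc : (fun x : E d => well (x o - c)) =
      fun x => (fun y : E d => well (y o)) (x - c • basisVec o) := by
    funext x
    simp
  set f : E d → ℝ := fun x => 2 + (-R⁻¹) • well (x o - c) with hf
  have hfcd : ContDiff ℝ (⊤ : ℕ∞) f := contDiff_const.add (hF'.const_smul (-R⁻¹))
  have hD : ∀ j, 1 ≤ j → j ≤ n → ‖iteratedFDeriv ℝ j f x‖ ≤ (B * R⁻¹) ^ j := by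
    intro j hj1 hjn
    have hj : ((j : ℕ) : WithTop ℕ∞) ≤ (⊤ : ℕ∞) := by exact_mod_cast le_top
    have h1 : iteratedFDeriv ℝ j f x =
        (-R⁻¹) • iteratedFDeriv ℝ j (fun x : E d => well (x o)) (x - c • basisVec o) := by
      have hsm : ContDiff ℝ j ((-R⁻¹) • fun x : E d => well (x o - c)) :=
        (hF'.of_le hj).const_smul (-R⁻¹)
      have h2 : f = (fun _ => (2 : ℝ)) + (-R⁻¹) • fun x : E d => well (x o - c) := rfl
      rw [h2, iteratedFDeriv_add_apply contDiffAt_const hsm.contDiffAt,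
        iteratedFDeriv_const_of_ne (by omega), iteratedFDeriv_const_smul_apply
        (hF'.of_le hj).contDiffAt, hFc,
        iteratedFDeriv_comp_sub (f := fun y : E d => well (y o)), Pi.zero_apply, zero_add]
    rw [h1, norm_smul, norm_neg, Real.norm_of_nonneg (by positivity), mul_comm]
    refine (mul_le_mul_of_nonneg_right (hB j (hjn.trans hn) _) (by positivity)).trans ?_
    exact le_self_pow₀ hBR (by omega)
  have h1 := norm_iteratedFDeriv_comp_le (Real.smoothTransition.contDiff (n := (⊤ : ℕ∞))) hfcd
    (n := n) (by exact_mod_cast le_top) x (C := C) (D := B * R⁻¹) (fun j hj => hC j (hj.trans hn) _ ?_)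
    hD
  · have h2 : pderiv σ (shear o i c R) x =
        (iteratedFDeriv ℝ n (Real.smoothTransition ∘ f) x fun j => basisVec (σ j)) •
          basisVec i := by
      have h3 : shear o i c R = ((ContinuousLinearMap.id ℝ ℝ).smulRight (basisVec i : E d)) ∘
          (Real.smoothTransition ∘ f) := by
        funext y
        simp only [shear, Function.comp, hf, ContinuousLinearMap.smulRight_apply,
          ContinuousLinearMap.id_apply, smul_eq_mul]
        congr 2
        ring
      unfold pderiv
      rw [h3, ContinuousLinearMap.iteratedFDeriv_comp_left (n := (⊤ : ℕ∞)) _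
        ((Real.smoothTransition.contDiff.comp hfcd).contDiffAt) (by exact_mod_cast le_top)]
      rfl
    rw [h2, norm_smul]
    have h4 : ‖(basisVec i : E d)‖ = 1 := by simp [basisVec]
    have h5 := (iteratedFDeriv ℝ n (Real.smoothTransition ∘ f) x).le_opNorm
      fun j => basisVec (σ j)
    have h6 : ∀ j, ‖(basisVec (σ j) : E d)‖ = 1 := fun j => by simp [basisVec]
    simp only [h6, Finset.prod_const_one, mul_one] at h5
    rw [h4, mul_one]
    refine h5.trans (h1.trans ?_)
    rw [mul_assoc _ (B ^ s), ← mul_pow]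
    refine mul_le_mul (mul_le_mul_of_nonneg_right ?_ hC0) (pow_le_pow_right₀ hBR hn)
      (by positivity) (by positivity)
    exact_mod_cast Nat.factorial_le hn
  · have : 0 ≤ R⁻¹ * well (x o - c) := mul_nonneg (by positivity) (well_nonneg _)
    simp only [hf, smul_eq_mul]
    linarith

end ShearBound

section Construction

variable {N : ℕ → ℕ} {s d : ℕ}

/-! ### Construction of the array -/

/-- If at most `M` vortices belong to each index `k`, slabs can be assigned such that the `k`-th
group uses slabs with numbers at most `d + M + M k`. -/
theorem exists_layout (o : Fin d) (hd : 2 ≤ d) {M : ℕ} (hM : ∀ k, N k ≤ M)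
    (dir : (Σ k, Fin (N k)) → Fin d) (hdir : ∀ a, dir a ≠ o) :
    ∃ L : VortexLayout N d, L.o = o ∧
      ∀ a : Σ k, Fin (N k), L.slot (Sum.inl a) ≤ d + M + M * a.1 := by
  refine ⟨{ o := o
            dir := Sum.elim dir fun i => i
            dir_ne := ?_
            dir_inr := fun i => rfl
            slot := Sum.elim (fun a => d + (M * a.1 + a.2)) fun i => i.1
            slot_injective := ?_
            two_le := hd }, rfl, ?_⟩
  · rintro (a | i)
    · exact hdir a
    · exact i.2
  · rintro (⟨k, n⟩ | i) (⟨k', n'⟩ | i') h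
    · have hn := n.2.trans_le (hM k)
      have hn' := n'.2.trans_le (hM k')
      have h1 : M * k + n = M * k' + n' := Nat.add_left_cancel h
      have hk : k = k' := by
        have h2 := congrArg (· / M) h1
        simpa [Nat.mul_add_div (by omega : 0 < M), Nat.div_eq_of_lt hn, Nat.div_eq_of_lt hn']
          using h2
      subst hk
      have hnn : n = n' := Fin.ext (Nat.add_left_cancel h1)
      rw [hnn]
    · have := i'.1.2
      have h1 : d + (M * k + n) = i'.1 := h
      omega
    · have := i.1.2
      have h1 : (i.1 : ℕ) = d + (M * k' + n') := h
      omega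
    · exact congrArg Sum.inr (Subtype.ext (Fin.ext h))
  · rintro ⟨k, n⟩
    have hn := n.2.trans_le (hM k)
    change d + (M * k + n) ≤ d + M + M * k
    omega

/-- The shear flows are summable in `C^s` if the frequencies decay fast enough. -/
theorem summable_shear_of_decay (L : VortexLayout N d) {M : ℕ} (hM : ∀ k, N k ≤ M)
    (hslot : ∀ a : Σ k, Fin (N k), L.slot (Sum.inl a) ≤ d + M + M * a.1) {ε : ℝ} (hε : 0 < ε)
    (hε' : ε * (4 ^ M) ^ s ≤ 1 / 2) {ν : Tangent N} {C : ℝ} (hν : ∀ k, ‖ν k‖ ≤ C * ε ^ k) :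
    Summable fun b => ‖speed b ν • L.shearField s b‖ := by
  obtain ⟨K, hK0, hK⟩ := exists_norm_shear_le L.o s
  have hC : 0 ≤ C := by simpa using (norm_nonneg _).trans (hν 0)
  have hnorm : ∀ a : Σ k, Fin (N k), ‖L.shearField s (Sum.inl a)‖ ≤
      K * (32 * 4 ^ (d + M)) ^ s * ((4 ^ M) ^ s) ^ a.1 := by
    intro a
    have hR := L.radiusSq_pos (Sum.inl a)
    have hinv : (L.radiusSq (Sum.inl a))⁻¹ ≤ 32 * 4 ^ (d + M) * (4 ^ M) ^ a.1 := by
      have h1 : (L.radiusSq (Sum.inl a))⁻¹ = 32 * 4 ^ L.slot (Sum.inl a) := by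
        rw [VortexLayout.radiusSq, slabRadiusSq, one_div, inv_pow, inv_div, div_inv_eq_mul]
      rw [h1, mul_assoc, ← pow_mul, ← pow_add]
      exact mul_le_mul_of_nonneg_left (pow_le_pow_right₀ (by norm_num) (hslot a)) (by norm_num)
    have h2 : ‖L.shearField s (Sum.inl a)‖ ≤ K * (L.radiusSq (Sum.inl a))⁻¹ ^ s := by
      refine (CPer.norm_le_iff _ (by positivity)).2 ?_
      exact hK _ _ _ hR ((L.radiusSq_le _).trans (by norm_num))
    refine h2.trans ?_
    rw [mul_assoc, ← pow_mul, mul_comm s a.1, pow_mul, ← mul_pow]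
    exact mul_le_mul_of_nonneg_left (pow_le_pow_left₀ (by positivity) hinv s) hK0
  refine Summable.sum _ ?_ ?_
  · change Summable fun a : Σ k, Fin (N k) =>
      ‖speed (Sum.inl a : VortexIndex N L.o) ν • L.shearField s (Sum.inl a)‖
    set D := C * (K * (32 * 4 ^ (d + M)) ^ s) with hD
    have hD0 : 0 ≤ D := by positivity
    have hterm : ∀ a : Σ k, Fin (N k),
        ‖speed (Sum.inl a : VortexIndex N L.o) ν • L.shearField s (Sum.inl a)‖ ≤
          D * (1 / 2) ^ a.1 := by
      intro a
      rw [norm_smul]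
      have h1 : ‖speed (Sum.inl a : VortexIndex N L.o) ν‖ ≤ C * ε ^ a.1 :=
        (PiLp.norm_apply_le (ν a.1) a.2).trans (hν a.1)
      refine (mul_le_mul h1 (hnorm a) (norm_nonneg _) (by positivity)).trans ?_
      have h2 : (ε * (4 ^ M) ^ s) ^ a.1 ≤ (1 / 2) ^ a.1 :=
        pow_le_pow_left₀ (by positivity) hε' _
      refine le_trans (le_of_eq ?_) (mul_le_mul_of_nonneg_left h2 hD0)
      rw [hD, mul_pow]
      ring
    refine Summable.of_nonneg_of_le (fun _ => norm_nonneg _) hterm ?_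
    rw [summable_sigma_of_nonneg fun a => by positivity]
    refine ⟨fun k => Summable.of_finite, ?_⟩
    have hgeo : Summable fun k : ℕ => M * (D * (1 / 2) ^ k) :=
      ((summable_geometric_of_lt_one (by norm_num) (by norm_num)).mul_left D).mul_left _
    refine Summable.of_nonneg_of_le (fun k => tsum_nonneg fun _ => by positivity)
      (fun k => ?_) hgeo
    rw [tsum_fintype]
    change ∑ _n : Fin (N k), D * (1 / 2) ^ k ≤ _
    rw [Finset.sum_const, Finset.card_univ, Fintype.card_fin, nsmul_eq_mul]
    exact mul_le_mul_of_nonneg_right (by exact_mod_cast hM k) (by positivity)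
  · exact Summable.of_finite

theorem exists_vortexArray (hs : 1 ≤ s) (L : VortexLayout N d) {ν : Tangent N}
    (hν : Summable fun b => ‖speed b ν • L.shearField s b‖) :
    ∃ W : VortexArray N s d, W.ν = ν := by
  choose bound hb using fun b => (L.exists_bound hs b).2.2
  have hb0 : ∀ b, |bound b| = bound b := fun b =>
    abs_of_nonneg ((norm_nonneg _).trans (hb b 0).1)
  obtain ⟨A, hA, h1, h2⟩ := exists_amplitude bound
  simp only [hb0] at h1 h2
  exact ⟨{ toVortexLayout := L
           one_le := hs
           ν := ν
           amp := A
           amp_pos := hA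
           bound := bound
           norm_vortex_le := fun b r => (hb b r).1
           norm_deriv_le := fun b r => (hb b r).2.1
           norm_pressure_le := fun b r => (hb b r).2.2
           summable_amp := h1
           summable_amp_sq := h2
           summable_shear := hν }, rfl⟩

theorem norm_le_of_bddAbove {ε : ℝ} (hε : 0 < ε) (hε1 : ε ≤ 1) {ν : Tangent N}
    (h : BddAbove (Set.range fun k : ℕ => ε ^ (-((s + 1 : ℤ) * k)) * ‖ν k‖)) :
    ∃ C, ∀ k, ‖ν k‖ ≤ C * ε ^ k := by
  obtain ⟨C, hC⟩ := h
  refine ⟨C, fun k => ?_⟩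
  have h1 : ε ^ (-((s + 1 : ℤ) * k)) * ‖ν k‖ ≤ C := hC ⟨k, rfl⟩
  have h2 : ε ^ (-((s + 1 : ℤ) * k)) = (ε ^ ((s + 1) * k))⁻¹ := by
    rw [zpow_neg, ← zpow_natCast]
    push_cast
    rfl
  rw [h2, inv_mul_le_iff₀ (by positivity), mul_comm] at h1
  have hC0 : 0 ≤ C := by
    have : 0 ≤ C * ε ^ ((s + 1) * k) := (norm_nonneg _).trans h1
    exact nonneg_of_mul_nonneg_left this (by positivity)
  refine h1.trans (mul_le_mul_of_nonneg_left ?_ hC0)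
  exact pow_le_pow_of_le_one hε.le hε1 (Nat.le_mul_of_pos_left k (Nat.succ_pos s))

end Construction

end

end EulerAP

open EulerAP
theorem theorem1 (d : ℕ) (hd : d = 3 ∨ Even d) (m : ℕ) (hm : 1 ≤ m) (hmd : m < d)
    (J : ℕ → ℕ) (hJb : BddAbove (Set.range J)) (hJ : J ≠ 0) (S : ℕ) (hS : 1 ≤ S) :
    ∃ ε₀ ∈ Set.Ioo (0 : ℝ) 1, ∀ ε ∈ Set.Ioo 0 ε₀,
      ∀ ν : Tangent (fun k => (d - m) * J k),
        BddAbove (Set.range fun k : ℕ => ε ^ (-((S + 1 : ℤ) * k)) * ‖ν k‖) →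
        ∃ (U : Torus (fun k => (d - m) * J k) → CDiv S d)
          (P : Torus (fun k => (d - m) * J k) → CPer S d ℝ)
          (u₀ : Torus (fun k => (d - m) * J k) → CDiv S d),
          IsC1b U ∧ IsEmb U ∧ NonSymmetric U ∧
          (∀ ϑ, IsInvNegLaplacianDiv
            (convect (U ϑ : CPer S d (E d)) (U ϑ : CPer S d (E d))) (P ϑ)) ∧
          (∀ θ,
            U (θ + toTorus ((0 : ℝ) • ν)) = u₀ θ ∧
            IsEulerSolution (fun t => ((U (θ + toTorus (t • ν)) : CPer S d (E d)) : E d → E d))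
              (fun t => P (θ + toTorus (t • ν)))) ∧
          ∀ η : ℝ, 0 < η → NonResonant η ν →
            ∀ θ, IsTimeAlmostPeriodic (fun k => (d - m) * J k) η
              (fun t => U (θ + toTorus (t • ν))) := by
  obtain ⟨Jmax, hJmax⟩ := hJb
  set M : ℕ := (d - m) * Jmax with hMdef
  have hM : ∀ k, (d - m) * J k ≤ M := fun k => Nat.mul_le_mul_left _ (hJmax ⟨k, rfl⟩)
  have hpow : (1 : ℝ) ≤ (4 ^ M) ^ S := one_le_pow₀ (one_le_pow₀ (by norm_num))
  refine ⟨1 / 2 / (4 ^ M) ^ S, ⟨by positivity, ?_⟩, fun ε hε ν hν => ?_⟩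
  · rw [div_lt_one (by positivity)]
    linarith
  have hεM : ε * (4 ^ M) ^ S ≤ 1 / 2 := ((lt_div_iff₀ (by positivity)).1 hε.2).le
  have hε1 : ε ≤ 1 := by nlinarith [hε.1]
  obtain ⟨C, hC⟩ := norm_le_of_bddAbove hε.1 hε1 hν
  -- The angles of each group are distributed over the last `d - m` directions.
  obtain ⟨L, -, hslot⟩ := exists_layout (N := fun k => (d - m) * J k) (⟨0, by omega⟩ : Fin d)
    (by omega) hM
    (fun a => ⟨m + a.2 % (d - m), by have := Nat.mod_lt (a.2 : ℕ) (by omega : 0 < d - m); omega⟩)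
    (fun a h => by have := congrArg Fin.val h; simp at this; omega)
  obtain ⟨W, rfl⟩ := exists_vortexArray hS L (summable_shear_of_decay L hM hslot hε.1 hεM hC)
  refine ⟨W.field, W.pressure, fun θ => W.field (θ + toTorus ((0 : ℝ) • W.ν)), W.isC1b_field,
    W.isEmb_field, W.nonSymmetric_field, W.isInvNegLaplacianDiv_pressure,
    fun θ => ⟨rfl, W.isEulerSolution θ⟩, fun η _ hres θ => ?_⟩
  exact ⟨W.ν, W.field, θ, hres, W.isC1_field, W.isEmb_field, fun t => rfl⟩
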